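/- Let $N\ge 0$ be an integer and let $A,B$ be real $N\times N$ matrices with $A$ symmetric and non-negative definite. Set $E(t)=e^{-tB}$ and assume that the symmetric matrix $C(t)=\int_0^t E(s)\,A\,E(s)^T\,ds$ is positive definite for every $t>0$ (this is equivalent to the hypoellipticity of the Ornstein–Uhlenbeck operator $\mathcal L$ below). Assume also that every complex eigenvalue of $B$ has zero real part, i.e. $\sigma(B)\subseteq i\mathbb R$. Let $$\mathcal L=\operatorname{tr}(AD^2)+\langle Bx,D\rangle \ \text{ in } \mathbb R^N,\qquad \mathcal K=\mathcal L-\partial_t\ \text{ in } \mathbb R^{N+1}=\mathbb R^N\times\mathbb R,$$ where $D$ and $D^2$ are the gradient and the Hessian in $x\in\mathbb R^N$. If $u:\mathbb R^{N+1}\to\mathbb R$ is a $C^\infty$ solution of $\mathcal K u=0$ in $\mathbb R^{N+1}$ with $\inf_{\mathbb R^{N+1}}u>-\infty$, then $$\lim_{t\to-\infty}u(x,t)=\inf_{\mathbb R^{N+1}}u\qquad\text{for every } x\in\mathbb R^N.$$ -/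

import Mathlib

open Filter Topology Matrix
open scoped ContDiff

namespace OrnsteinUhlenbeck

noncomputable section

/-- The matrix exponential `E(t) = e^{-tB}`. -/
def E {N : ℕ} (B : Matrix (Fin N) (Fin N) ℝ) (t : ℝ) : Matrix (Fin N) (Fin N) ℝ :=
  NormedSpace.exp ((-t) • B)

/-- The matrix `C(t) = ∫₀ᵗ E(s) A E(s)ᵀ ds`, integrated entry by entry. -/
def C {N : ℕ} (A B : Matrix (Fin N) (Fin N) ℝ) (t : ℝ) : Matrix (Fin N) (Fin N) ℝ :=
  Matrix.of fun i j => ∫ s in (0 : ℝ)..t, (E B s * A * (E B s)ᵀ) i j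

/-- The Hessian matrix `D²v(x)`, with entries `∂ᵢ∂ⱼ v(x)`. -/
def hessian {N : ℕ} (v : EuclideanSpace ℝ (Fin N) → ℝ) (x : EuclideanSpace ℝ (Fin N)) :
    Matrix (Fin N) (Fin N) ℝ :=
  Matrix.of fun i j =>
    fderiv ℝ (fun y => fderiv ℝ v y (EuclideanSpace.single j 1)) x (EuclideanSpace.single i 1)

/-- The Ornstein–Uhlenbeck operator `L v = tr(A D²v) + ⟨Bx, Dv⟩` on `ℝᴺ`. -/
def L {N : ℕ} (A B : Matrix (Fin N) (Fin N) ℝ) (v : EuclideanSpace ℝ (Fin N) → ℝ)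
    (x : EuclideanSpace ℝ (Fin N)) : ℝ :=
  (A * hessian v x).trace + inner ℝ (WithLp.toLp 2 (B *ᵥ x.ofLp)) (gradient v x)

/-- The Kolmogorov operator `K u = L u - ∂ₜ u` on `ℝᴺ⁺¹ = ℝᴺ × ℝ`, where `L` acts in the space
variable `x` and points are written `z = (x, t)`. -/
def K {N : ℕ} (A B : Matrix (Fin N) (Fin N) ℝ) (u : EuclideanSpace ℝ (Fin N) × ℝ → ℝ)
    (z : EuclideanSpace ℝ (Fin N) × ℝ) : ℝ :=
  L A B (fun x => u (x, z.2)) z.1 - deriv (fun t => u (z.1, t)) z.2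

end

end OrnsteinUhlenbeck

/-!
After subtracting its infimum, `u` is a nonnegative solution, and it suffices to show that the
values `u(x, t)` for very negative `t` are bounded by `e · u(x₀, t₀)` for every point `(x₀, t₀)`:
choosing `(x₀, t₀)` with `u(x₀, t₀)` close to the infimum gives the limit. This is a Harnack
inequality with a universal constant (`eventually_le_exp_one_mul`), obtained from the explicit
Gaussian kernel `Γ` of `L - ∂ₜ`.

*Representation.* A nonnegative solution equals the average of its values at any earlier time `t - T`
against `Γ`. The exponent of `Γ` is `-⟨C(T)⁻¹v, v⟩ / 4` with `v = E(T)z - x`, and its prefactor is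
`det C(T)^{-1/2}`, as `tr B = 0`. No growth is assumed of `u`, so the kernel, mollified at lag `0`
by a Gaussian of variance `ε`, is truncated by a convex function which vanishes for small values.
The truncated kernel has compact support and is a subsolution of the forward equation; its defect is
an explicit nonnegative *dissipation*. Hence the truncated average decreases with the lag
(`pairing_le_pairing_zero`), which gives `average ≤ u(x, t)` in the limit (`integral_kernel_le`).
In particular averages against `Γ` are finite. This finiteness, for a pole shifted by one unit of
time, shows that the total dissipation is exponentially small in the truncation level
(`exists_pairing_zero_le`), which gives the reverse inequality (`mul_kernelMass_le_of_pairing_le`).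

*Comparison of kernels.* Let `b = E(h)x - x₀`. Subadditivity of `(M, v) ↦ ⟨M⁻¹v, v⟩` together with
`C(h + T) = C(h) + E(h) C(T) E(h)ᵀ` bounds the kernel with pole `(x, t)` and lag `T` by the kernel
with pole `(x₀, t + h)` and lag `T + h`, up to `exp (⟨C(h)⁻¹b, b⟩ / 2)` and a power of
`det C(T + h) / det C(T)`. The representation turns this into `le_exp_mul`.

*Growth.* The hypothesis on the spectrum enters through Gelfand's formula: `‖E(k)‖`, and therefore
`det C(k)`, grows subexponentially. So `det C(T + h) / det C(T)` is as close to `1` as one wishes for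
suitable `T` (`exists_det_C_ratio_le`). By the matrix determinant lemma this also forces
`⟨C(h)⁻¹x₀, x₀⟩` and `⟨C(h)⁻¹E(h)x, E(h)x⟩` to tend to zero as `h → ∞`, and the constant in the
Harnack inequality drops below `e`.
-/

set_option linter.unusedSectionVars false

namespace OrnsteinUhlenbeck

/-! ### Quadratic forms and determinants of positive matrices -/

section Quadratic

variable {n : Type*} [Fintype n] [DecidableEq n] {M X Y : Matrix n n ℝ}

lemma dotProduct_mulVec_comm_of_isHermitian (hM : M.IsHermitian) (v w : n → ℝ) :
    v ⬝ᵥ M *ᵥ w = w ⬝ᵥ M *ᵥ v := by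
  have h : Mᵀ = M := by simpa [IsHermitian, conjTranspose_eq_transpose_of_trivial] using hM
  rw [dotProduct_comm, ← h, mulVec_transpose, h, dotProduct_mulVec]

lemma mulVec_inv_mulVec (hM : M.PosDef) (v : n → ℝ) : M *ᵥ M⁻¹ *ᵥ v = v := by
  rw [mulVec_mulVec, mul_nonsing_inv _ hM.det_pos.ne'.isUnit, one_mulVec]

lemma form_nonneg (hM : M.PosSemidef) (v : n → ℝ) : 0 ≤ v ⬝ᵥ M *ᵥ v := by
  simpa using hM.dotProduct_mulVec_nonneg v

/-- Young's inequality for the dual pair of quadratic forms given by `M` and `M⁻¹`. -/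
lemma two_mul_dotProduct_le (hM : M.PosDef) (v w : n → ℝ) :
    2 * (v ⬝ᵥ w) ≤ v ⬝ᵥ M⁻¹ *ᵥ v + w ⬝ᵥ M *ᵥ w := by
  have h := form_nonneg hM.posSemidef (w - M⁻¹ *ᵥ v)
  rw [mulVec_sub, mulVec_inv_mulVec hM, sub_dotProduct, dotProduct_sub, dotProduct_sub,
    dotProduct_mulVec_comm_of_isHermitian hM.1 (M⁻¹ *ᵥ v) w, mulVec_inv_mulVec hM,
    dotProduct_comm w v, dotProduct_comm (M⁻¹ *ᵥ v) v] at h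
  linarith

/-- The form of `M⁻¹` is the Legendre transform of the form of `M`: an upper bound for the
concave functions `w ↦ 2⟨v, w⟩ - ⟨Mw, w⟩` bounds `⟨M⁻¹v, v⟩`. -/
lemma inv_form_le (hM : M.PosDef) {v : n → ℝ} {Z : ℝ}
    (h : ∀ w, 2 * (v ⬝ᵥ w) - w ⬝ᵥ M *ᵥ w ≤ Z) : v ⬝ᵥ M⁻¹ *ᵥ v ≤ Z := by
  have := h (M⁻¹ *ᵥ v)
  rw [mulVec_inv_mulVec hM, dotProduct_comm (M⁻¹ *ᵥ v) v] at this
  linarith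

lemma exists_eq_transpose_mul_self (hM : M.PosSemidef) : ∃ R : Matrix n n ℝ, M = Rᵀ * R := by
  open scoped MatrixOrder in
  obtain ⟨R, hR⟩ := CStarAlgebra.nonneg_iff_eq_star_mul_self.mp hM.nonneg
  exact ⟨R, by simpa [star_eq_conjTranspose, conjTranspose_eq_transpose_of_trivial] using hR⟩

lemma form_le_trace_mul (hM : M.PosSemidef) (w : n → ℝ) :
    w ⬝ᵥ M *ᵥ w ≤ M.trace * (w ⬝ᵥ w) := by
  obtain ⟨R, rfl⟩ := exists_eq_transpose_mul_self hM
  have h1 : w ⬝ᵥ (Rᵀ * R) *ᵥ w = ∑ i, (∑ j, R i j * w j) ^ 2 := by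
    rw [← mulVec_mulVec, dotProduct_mulVec, vecMul_transpose]
    simp [dotProduct, mulVec, sq]
  have h2 : (Rᵀ * R).trace * (w ⬝ᵥ w) = ∑ i, (∑ j, R i j ^ 2) * (∑ j, w j ^ 2) := by
    rw [trace_mul_comm, ← Finset.sum_mul]
    simp [trace, mul_apply, dotProduct, sq]
  rw [h1, h2]
  exact Finset.sum_le_sum fun i _ => Finset.sum_mul_sq_le_sq_mul_sq _ _ _

/-- The smallest eigenvalue of `M⁻¹` is at least the inverse of the trace of `M`. -/
lemma dotProduct_self_le_trace_mul_inv_form (hM : M.PosDef) (v : n → ℝ) :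
    v ⬝ᵥ v ≤ M.trace * (v ⬝ᵥ M⁻¹ *ᵥ v) := by
  rcases eq_or_ne v 0 with rfl | hv
  · simp
  have ha : 0 < v ⬝ᵥ v := by simpa using dotProduct_star_self_pos_iff.2 hv
  have hp : 0 < v ⬝ᵥ M *ᵥ v := by simpa using hM.dotProduct_mulVec_pos hv
  have ht := form_le_trace_mul hM.posSemidef v
  have htr : 0 < M.trace := by
    by_contra! h
    nlinarith
  have h := two_mul_dotProduct_le hM v (M.trace⁻¹ • v)
  rw [mulVec_smul, dotProduct_smul, smul_dotProduct, dotProduct_smul] at h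
  simp only [smul_eq_mul] at h
  have h3 : M.trace⁻¹ * (M.trace⁻¹ * (v ⬝ᵥ M *ᵥ v)) ≤ M.trace⁻¹ * (v ⬝ᵥ v) := by
    have : M.trace⁻¹ * (v ⬝ᵥ M *ᵥ v) ≤ v ⬝ᵥ v := by
      rw [inv_mul_le_iff₀ htr]; exact ht
    gcongr
  have h4 : M.trace⁻¹ * (v ⬝ᵥ v) ≤ v ⬝ᵥ M⁻¹ *ᵥ v := by linarith
  rwa [inv_mul_le_iff₀ htr] at h4

lemma exists_pos_mul_le_form (hM : M.PosDef) :
    ∃ lam : ℝ, 0 < lam ∧ ∀ w, lam * (w ⬝ᵥ w) ≤ w ⬝ᵥ M *ᵥ w := by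
  have h0 : 0 ≤ M⁻¹.trace := hM.inv.posSemidef.trace_nonneg
  refine ⟨(M⁻¹.trace + 1)⁻¹, by positivity, fun w => ?_⟩
  rw [inv_mul_le_iff₀ (by positivity)]
  have h := dotProduct_self_le_trace_mul_inv_form hM.inv w
  rw [nonsing_inv_nonsing_inv _ hM.det_pos.ne'.isUnit] at h
  nlinarith [form_nonneg hM.posSemidef w]

lemma dotProduct_inv_mulVec_self_le (hM : M.PosDef) {ε : ℝ}
    (h : ∀ w, ε * (w ⬝ᵥ w) ≤ w ⬝ᵥ M *ᵥ w) (v : n → ℝ) :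
    ε * ((M⁻¹ *ᵥ v) ⬝ᵥ (M⁻¹ *ᵥ v)) ≤ v ⬝ᵥ M⁻¹ *ᵥ v := by
  have := h (M⁻¹ *ᵥ v)
  rwa [mulVec_inv_mulVec hM, dotProduct_comm (M⁻¹ *ᵥ v) v] at this

lemma det_add_vecMulVec (hX : X.PosDef) (v : n → ℝ) :
    (X + vecMulVec v v).det = X.det * (1 + v ⬝ᵥ X⁻¹ *ᵥ v) := by
  have h : vecMulVec v v = replicateCol Unit v * replicateRow Unit v :=
    vecMulVec_eq Unit v v
  rw [h, det_add_replicateCol_mul_replicateRow hX.det_pos.ne'.isUnit, det_unique (n := Unit)]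
  congr 1
  rw [Matrix.add_apply, one_apply_eq, Matrix.mul_assoc]
  simp [mul_apply, dotProduct, mulVec]

lemma posSemidef_vecMulVec_self (v : n → ℝ) : (vecMulVec v v).PosSemidef := by
  simpa using posSemidef_vecMulVec_self_star v

lemma det_le_det_add (hX : X.PosDef) (hY : Y.PosSemidef) : X.det ≤ (X + Y).det := by
  obtain ⟨R, rfl⟩ := exists_eq_transpose_mul_self hY
  have hR : Rᵀ * R = ∑ i, vecMulVec (R i) (R i) := by
    ext i j
    simp [mul_apply, Matrix.sum_apply, vecMulVec_apply]
  rw [hR]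
  suffices h : ∀ s : Finset n, (X + ∑ i ∈ s, vecMulVec (R i) (R i)).PosDef ∧
      X.det ≤ (X + ∑ i ∈ s, vecMulVec (R i) (R i)).det from (h _).2
  intro s
  induction s using Finset.induction_on with
  | empty => simpa using hX
  | insert i s hi ih =>
    rw [Finset.sum_insert hi, add_comm (vecMulVec _ _), ← add_assoc]
    refine ⟨ih.1.add_posSemidef (posSemidef_vecMulVec_self _), ?_⟩
    rw [det_add_vecMulVec ih.1]
    have h1 := form_nonneg ih.1.inv.posSemidef (R i)
    have h2 := ih.1.det_pos
    nlinarith [ih.2]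

lemma dotProduct_vecMulVec_self (v w : n → ℝ) : w ⬝ᵥ vecMulVec v v *ᵥ w = (v ⬝ᵥ w) ^ 2 := by
  rw [vecMulVec_mulVec]
  simp [dotProduct_comm w v, sq]

/-- Adding to `X` a positive matrix that dominates `v vᵀ` multiplies the determinant by at least
`1 + ⟨X⁻¹v, v⟩`. -/
lemma det_mul_one_add_inv_form_le (hX : X.PosDef) (hY : Y.IsHermitian) {v : n → ℝ}
    (h : ∀ w, (v ⬝ᵥ w) ^ 2 ≤ w ⬝ᵥ Y *ᵥ w) :
    X.det * (1 + v ⬝ᵥ X⁻¹ *ᵥ v) ≤ (X + Y).det := by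
  have hZ : (Y - vecMulVec v v).PosSemidef := by
    refine PosSemidef.of_dotProduct_mulVec_nonneg
      (hY.sub (posSemidef_vecMulVec_self v).1) fun w => ?_
    simp only [star_trivial]
    rw [sub_mulVec, dotProduct_sub, dotProduct_vecMulVec_self]
    linarith [h w]
  have h1 := det_le_det_add (hX.add_posSemidef (posSemidef_vecMulVec_self v)) hZ
  rwa [det_add_vecMulVec hX, add_assoc, add_sub_cancel] at h1

end Quadratic

/-! ### The matrix exponential: semigroup law, trace and subexponential growth -/

section Exponential

open scoped Matrix.Norms.Operator

lemma exp_mulVec_of_eigenvector {N : ℕ} {D : Matrix (Fin N) (Fin N) ℂ} {μ : ℂ} {v : Fin N → ℂ}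
    (h : D *ᵥ v = μ • v) : NormedSpace.exp D *ᵥ v = Complex.exp μ • v := by
  have hpow : ∀ k : ℕ, D ^ k *ᵥ v = μ ^ k • v := by
    intro k
    induction k with
    | zero => simp
    | succ k ih => rw [pow_succ, ← mulVec_mulVec, h, mulVec_smul, ih, smul_smul, pow_succ']
  have h1 := (NormedSpace.exp_series_hasSum_exp' (𝕂 := ℂ) D).map
    ((mulVecBilin ℂ ℂ).flip v : Matrix (Fin N) (Fin N) ℂ →ₗ[ℂ] (Fin N → ℂ)).toAddMonoidHom
    (LinearMap.continuous_of_finiteDimensional _)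
  have h2 := (NormedSpace.exp_series_hasSum_exp' (𝕂 := ℂ) μ).smul_const v
  rw [Complex.exp_eq_exp_ℂ]
  refine h1.unique (h2.congr_fun fun k => ?_)
  simp [hpow, smul_smul]

/-- Spectral mapping: an eigenspace of `exp D` is invariant under `D`, so it contains an eigenvector
of `D`. -/
lemma norm_eq_one_of_mem_spectrum_exp {N : ℕ} {D : Matrix (Fin N) (Fin N) ℂ}
    (hD : ∀ μ ∈ spectrum ℂ D, μ.re = 0) {z : ℂ} (hz : z ∈ spectrum ℂ (NormedSpace.exp D)) :
    ‖z‖ = 1 := by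
  set f : Module.End ℂ (Fin N → ℂ) := toLin' (NormedSpace.exp D) with hf
  set g : Module.End ℂ (Fin N → ℂ) := toLin' D with hg
  have hfz : f.HasEigenvalue z := by
    rw [Module.End.hasEigenvalue_iff_mem_spectrum, hf, spectrum_toLin']
    exact hz
  have hcomm : Commute f g := by
    have : Commute (NormedSpace.exp D) D := (Commute.refl D).exp_left
    rw [commute_iff_eq, hf, hg, Module.End.mul_eq_comp, Module.End.mul_eq_comp, ← toLin'_mul,
      ← toLin'_mul, this.eq]
  have hmap : Set.MapsTo g (f.eigenspace z) (f.eigenspace z) :=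
    Module.End.mapsTo_genEigenspace_of_comm hcomm z 1
  have : Nontrivial (f.eigenspace z) := Submodule.nontrivial_iff_ne_bot.2 hfz
  obtain ⟨μ, hμ⟩ := Module.End.exists_eigenvalue (g.restrict hmap)
  obtain ⟨w, hw⟩ := hμ.exists_hasEigenvector
  have hw0 : (w : Fin N → ℂ) ≠ 0 := by
    simpa using hw.2
  have hgw : g w = μ • (w : Fin N → ℂ) := congrArg Subtype.val hw.apply_eq_smul
  have hDw : D *ᵥ (w : Fin N → ℂ) = μ • (w : Fin N → ℂ) := by simpa [hg] using hgw
  have hμ0 : μ.re = 0 := by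
    refine hD μ ?_
    rw [← spectrum_toLin', ← Module.End.hasEigenvalue_iff_mem_spectrum]
    exact Module.End.hasEigenvalue_of_hasEigenvector
      (Module.End.hasEigenvector_iff.2 ⟨Module.End.mem_eigenspace_iff.2 hgw, hw0⟩)
  have h1 : NormedSpace.exp D *ᵥ (w : Fin N → ℂ) = z • (w : Fin N → ℂ) := by
    simpa [hf] using Module.End.mem_eigenspace_iff.1 w.2
  rw [exp_mulVec_of_eigenvector hDw] at h1
  have h2 : Complex.exp μ = z := smul_left_injective ℂ hw0 h1
  rw [← h2, Complex.norm_exp, hμ0, Real.exp_zero]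

open scoped ENNReal in
/-- If the spectrum of `T` lies in the closed unit disc, then the powers of `T` grow
subexponentially (Gelfand's formula). -/
lemma exists_norm_pow_le {N : ℕ} {T : Matrix (Fin N) (Fin N) ℂ}
    (hT : ∀ z ∈ spectrum ℂ T, ‖z‖ ≤ 1) {ρ : ℝ} (hρ : 1 < ρ) :
    ∃ c : ℝ, 0 < c ∧ ∀ k : ℕ, ‖T ^ k‖ ≤ c * ρ ^ k := by
  have hr : spectralRadius ℂ T ≤ 1 := iSup₂_le fun z hz => by
    exact_mod_cast (hT z hz : ‖z‖₊ ≤ 1)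
  have hlt : spectralRadius ℂ T < ENNReal.ofReal ρ :=
    hr.trans_lt (by simpa using hρ)
  have hev := (spectrum.pow_norm_pow_one_div_tendsto_nhds_spectralRadius T).eventually_lt_const hlt
  obtain ⟨n, hn⟩ := eventually_atTop.1 hev
  have hρ0 : 0 < ρ := by linarith
  have hlarge : ∀ k, n + 1 ≤ k → ‖T ^ k‖ ≤ ρ ^ k := by
    intro k hk
    have h1 := (ENNReal.ofReal_lt_ofReal_iff hρ0).1 (hn k (by omega))
    have hk0 : (k : ℝ) ≠ 0 := by
      have : k ≠ 0 := by omega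
      exact_mod_cast this
    have h2 : (‖T ^ k‖ ^ (1 / k : ℝ)) ^ k ≤ ρ ^ k :=
      pow_le_pow_left₀ (by positivity) h1.le k
    rwa [← Real.rpow_natCast, ← Real.rpow_mul (norm_nonneg _), one_div, inv_mul_cancel₀ hk0,
      Real.rpow_one] at h2
  refine ⟨1 + ∑ j ∈ Finset.range (n + 1), ‖T ^ j‖, by positivity, fun k => ?_⟩
  have hρk : 1 ≤ ρ ^ k := one_le_pow₀ hρ.le
  have hs : 0 ≤ ∑ j ∈ Finset.range (n + 1), ‖T ^ j‖ := by positivity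
  rcases le_or_gt (n + 1) k with hk | hk
  · nlinarith [hlarge k hk]
  · have := Finset.single_le_sum (f := fun j => ‖T ^ j‖) (fun _ _ => norm_nonneg _)
      (Finset.mem_range.2 hk)
    nlinarith

variable {N : ℕ} {A B : Matrix (Fin N) (Fin N) ℝ}

lemma E_zero (B : Matrix (Fin N) (Fin N) ℝ) : E B 0 = 1 := by simp [E]

lemma E_add (B : Matrix (Fin N) (Fin N) ℝ) (s t : ℝ) : E B (s + t) = E B s * E B t := by
  rw [E, E, E, ← Matrix.exp_add_of_commute]
  · congr 1
    rw [← add_smul]; congr 1; ring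
  · exact ((Commute.refl B).smul_left _).smul_right _

lemma E_neg_mul (B : Matrix (Fin N) (Fin N) ℝ) (t : ℝ) : E B (-t) * E B t = 1 := by
  rw [← E_add]; simp [E_zero]

lemma hasDerivAt_E (B : Matrix (Fin N) (Fin N) ℝ) (t : ℝ) :
    HasDerivAt (E B) (-(E B t * B)) t := by
  have h := (hasDerivAt_exp_smul_const (𝕂 := ℝ) B (-t)).scomp t (hasDerivAt_neg t)
  rw [neg_one_smul] at h
  exact h

lemma continuous_E (B : Matrix (Fin N) (Fin N) ℝ) : Continuous (E B) :=
  continuous_iff_continuousAt.2 fun t => (hasDerivAt_E B t).continuousAt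

lemma trace_eq_zero (hB : ∀ μ ∈ spectrum ℂ (B.map (fun r : ℝ => (r : ℂ))), μ.re = 0) :
    B.trace = 0 := by
  have h1 : ((B.trace : ℝ) : ℂ) = (B.map (fun r : ℝ => (r : ℂ))).trace := by
    simp [trace]
  have h2 : ∀ s : Multiset ℂ, (∀ μ ∈ s, μ.re = 0) → s.sum.re = 0 := by
    intro s
    induction s using Multiset.induction_on with
    | empty => simp
    | cons a s ih =>
      intro h
      rw [Multiset.sum_cons, Complex.add_re, h a (by simp),
        ih fun μ hμ => h μ (Multiset.mem_cons_of_mem hμ), add_zero]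
  have h3 := h2 (B.map (fun r : ℝ => (r : ℂ))).charpoly.roots fun μ hμ =>
    hB μ (mem_spectrum_iff_isRoot_charpoly.2 (Polynomial.isRoot_of_mem_roots hμ))
  rw [← trace_eq_sum_roots_charpoly, ← h1, Complex.ofReal_re] at h3
  exact h3

lemma exists_norm_E_le (hB : ∀ μ ∈ spectrum ℂ (B.map (fun r : ℝ => (r : ℂ))), μ.re = 0)
    {ρ : ℝ} (hρ : 1 < ρ) : ∃ c : ℝ, 0 < c ∧ ∀ k : ℕ, ‖E B k‖ ≤ c * ρ ^ k := by
  set D := B.map (fun r : ℝ => (r : ℂ)) with hD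
  have hspec : ∀ μ ∈ spectrum ℂ (-D), μ.re = 0 := by
    intro μ hμ
    rw [← spectrum.neg_eq, Set.mem_neg] at hμ
    simpa using hB _ hμ
  obtain ⟨c, hc, h⟩ := exists_norm_pow_le
    (fun z hz => (norm_eq_one_of_mem_spectrum_exp hspec hz).le) hρ
  refine ⟨c, hc, fun k => ?_⟩
  have hmap : (E B k).map (fun r : ℝ => (r : ℂ)) = NormedSpace.exp (-D) ^ k := by
    rw [← Matrix.exp_nsmul]
    have hcont : Continuous (Complex.ofRealHom.mapMatrix :
        Matrix (Fin N) (Fin N) ℝ →+* Matrix (Fin N) (Fin N) ℂ) := by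
      exact Continuous.matrix_map continuous_id Complex.continuous_ofReal
    have := NormedSpace.map_exp (Complex.ofRealHom.mapMatrix :
        Matrix (Fin N) (Fin N) ℝ →+* Matrix (Fin N) (Fin N) ℂ) hcont ((-(k : ℝ)) • B)
    refine this.trans ?_
    congr 1
    ext i j
    simp [hD]
  have hnorm : ‖E B k‖ = ‖(E B k).map (fun r : ℝ => (r : ℂ))‖ := by
    rw [linfty_opNorm_def, linfty_opNorm_def]
    simp
  rw [hnorm, hmap]
  exact h k

end Exponential

/-! ### Jacobi's formula and the covariance matrix -/

section Covariance

open scoped Matrix.Norms.Operator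

variable {N : ℕ} {A B : Matrix (Fin N) (Fin N) ℝ}

lemma contDiff_det : ContDiff ℝ ∞ (fun X : Matrix (Fin N) (Fin N) ℝ => X.det) := by
  simp_rw [det_apply]
  refine ContDiff.sum fun σ _ => ContDiff.const_smul _ (contDiff_prod fun i _ => ?_)
  exact (entryLinearMap ℝ ℝ (σ i) i).toContinuousLinearMap.contDiff

/-- **Jacobi's formula** for the derivative of the determinant at an invertible matrix. -/
lemma hasDerivAt_det {M : ℝ → Matrix (Fin N) (Fin N) ℝ} {M' : Matrix (Fin N) (Fin N) ℝ} {t : ℝ}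
    (hM : HasDerivAt M M' t) (h : (M t).det ≠ 0) :
    HasDerivAt (fun s => (M s).det) ((M t).det * ((M t)⁻¹ * M').trace) t := by
  have hdiff : DifferentiableAt ℝ (fun X : Matrix (Fin N) (Fin N) ℝ => X.det) (M t) :=
    contDiff_det.differentiable (by simp) _
  have h1 := hdiff.hasFDerivAt.comp_hasDerivAt t hM
  -- the derivative along the segment `M t + s • M'` is read off from `det (1 + s • X)`
  have hline : HasDerivAt (fun s : ℝ => M t + s • M') M' 0 := by
    exact (((hasDerivAt_id (0 : ℝ)).smul_const M').const_add (M t)).congr_deriv (one_smul _ _)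
  have h2 := HasFDerivAt.comp_hasDerivAt (0 : ℝ)
    (l := fun X : Matrix (Fin N) (Fin N) ℝ => X.det)
    (by rw [zero_smul, add_zero]; exact hdiff.hasFDerivAt) hline
  have hpoly : ∀ s : ℝ, (M t + s • M').det = (M t).det * (1 + ((M t)⁻¹ * M').trace * s +
      (((1 + (Polynomial.X : Polynomial ℝ) • ((M t)⁻¹ * M').map Polynomial.C).det.divX.divX).eval s)
        * s ^ 2) := by
    intro s
    rw [← det_one_add_smul, ← det_mul, mul_add, mul_one, Matrix.mul_smul,
      mul_nonsing_inv_cancel_left _ _ h.isUnit]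
  have h3 : HasDerivAt (fun s : ℝ => (M t + s • M').det)
      ((M t).det * ((M t)⁻¹ * M').trace) 0 := by
    simp_rw [hpoly]
    refine HasDerivAt.const_mul _ ?_
    set q := (1 + (Polynomial.X : Polynomial ℝ) • ((M t)⁻¹ * M').map Polynomial.C).det.divX.divX
    have := (((hasDerivAt_id (0 : ℝ)).const_mul ((M t)⁻¹ * M').trace).const_add 1).add
      ((q.hasDerivAt 0).mul ((hasDerivAt_id (0 : ℝ)).pow 2))
    refine this.congr_deriv ?_
    simp
  rw [h2.unique h3] at h1
  exact h1

lemma det_E (hB : B.trace = 0) (t : ℝ) : (E B t).det = 1 := by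
  have hu : ∀ t, (E B t).det ≠ 0 := fun t h => by
    have := congrArg det (E_neg_mul B t)
    rw [det_mul, h, mul_zero, det_one] at this
    exact zero_ne_one this
  have h : ∀ t, HasDerivAt (fun s => (E B s).det) 0 t := fun t => by
    refine (hasDerivAt_det (hasDerivAt_E B t) (hu t)).congr_deriv ?_
    rw [mul_neg, nonsing_inv_mul_cancel_left _ _ (hu t).isUnit, trace_neg, hB, neg_zero, mul_zero]
  have := is_const_of_deriv_eq_zero (fun t => (h t).differentiableAt) (fun t => (h t).deriv) t 0
  simpa [E_zero] using this

lemma hasDerivAt_C (A B : Matrix (Fin N) (Fin N) ℝ) (t : ℝ) :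
    HasDerivAt (C A B) (E B t * A * (E B t)ᵀ) t := by
  have hcont : Continuous fun s => E B s * A * (E B s)ᵀ :=
    ((continuous_E B).matrix_mul continuous_const).matrix_mul (continuous_E B).matrix_transpose
  refine hasDerivAt_pi.2 fun i => hasDerivAt_pi.2 fun j => ?_
  exact intervalIntegral.integral_hasDerivAt_right ((hcont.matrix_elem i j).intervalIntegrable _ _)
    ((hcont.matrix_elem i j).stronglyMeasurableAtFilter _ _) (hcont.matrix_elem i j).continuousAt

lemma C_zero (A B : Matrix (Fin N) (Fin N) ℝ) : C A B 0 = 0 := by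
  ext i j; simp [C]

lemma continuous_C (A B : Matrix (Fin N) (Fin N) ℝ) : Continuous (C A B) :=
  continuous_iff_continuousAt.2 fun t => (hasDerivAt_C A B t).continuousAt

lemma transpose_C (hA : A.IsHermitian) (t : ℝ) : (C A B t)ᵀ = C A B t := by
  have hA' : Aᵀ = A := by simpa [IsHermitian, conjTranspose_eq_transpose_of_trivial] using hA
  have : ∀ s, (E B s * A * (E B s)ᵀ)ᵀ = E B s * A * (E B s)ᵀ := fun s => by
    simp [transpose_mul, hA', Matrix.mul_assoc]
  ext i j
  simp only [C, transpose_apply, of_apply]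
  congr 1
  ext s
  conv_rhs => rw [← this s]
  rfl

lemma C_add (A B : Matrix (Fin N) (Fin N) ℝ) (h r : ℝ) :
    C A B (h + r) = C A B h + E B h * C A B r * (E B h)ᵀ := by
  set f : ℝ → Matrix (Fin N) (Fin N) ℝ :=
    fun r => C A B (h + r) - (C A B h + E B h * C A B r * (E B h)ᵀ) with hf
  have hd : ∀ r, HasDerivAt f 0 r := by
    intro r
    have h1 := (hasDerivAt_C A B (h + r)).scomp r ((hasDerivAt_id r).const_add h)
    have h2 := ((((hasDerivAt_C A B r).const_mul (E B h)).mul_const (E B h)ᵀ).const_add (C A B h))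
    refine (h1.sub h2).congr_deriv ?_
    rw [E_add, transpose_mul]
    simp [Matrix.mul_assoc]
  have := is_const_of_deriv_eq_zero (fun t => (hd t).differentiableAt) (fun t => (hd t).deriv) r 0
  simp only [hf, add_zero, C_zero, Matrix.mul_zero, Matrix.zero_mul, sub_self] at this
  exact sub_eq_zero.1 this

lemma C_form_add (A B : Matrix (Fin N) (Fin N) ℝ) (h r : ℝ) (w : Fin N → ℝ) :
    w ⬝ᵥ C A B (h + r) *ᵥ w =
      w ⬝ᵥ C A B h *ᵥ w + ((E B h)ᵀ *ᵥ w) ⬝ᵥ C A B r *ᵥ ((E B h)ᵀ *ᵥ w) := by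
  rw [C_add, add_mulVec, dotProduct_add, ← mulVec_mulVec, ← mulVec_mulVec,
    dotProduct_mulVec w (E B h), ← mulVec_transpose (E B h) w]

lemma posSemidef_C (hC : ∀ t : ℝ, 0 < t → (C A B t).PosDef) {t : ℝ}
    (ht : 0 ≤ t) : (C A B t).PosSemidef := by
  rcases ht.eq_or_lt with rfl | ht
  · rw [C_zero]; exact PosSemidef.zero
  · exact (hC t ht).posSemidef

lemma C_form_mono (hC : ∀ t : ℝ, 0 < t → (C A B t).PosDef) {s t : ℝ}
    (hst : s ≤ t) (w : Fin N → ℝ) : w ⬝ᵥ C A B s *ᵥ w ≤ w ⬝ᵥ C A B t *ᵥ w := by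
  have := C_form_add A B s (t - s) w
  rw [add_sub_cancel] at this
  rw [this]
  linarith [form_nonneg (posSemidef_C hC (sub_nonneg.2 hst)) ((E B s)ᵀ *ᵥ w)]

lemma det_C_mono (hC : ∀ t : ℝ, 0 < t → (C A B t).PosDef) {s t : ℝ}
    (hs : 0 < s) (hst : s ≤ t) : (C A B s).det ≤ (C A B t).det := by
  have h : C A B t = C A B s + E B s * C A B (t - s) * (E B s)ᴴ := by
    rw [conjTranspose_eq_transpose_of_trivial, ← C_add, add_sub_cancel]
  rw [h]
  exact det_le_det_add (hC s hs)
    ((posSemidef_C hC (sub_nonneg.2 hst)).mul_mul_conjTranspose_same _)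

end Covariance

/-! ### Subexponential growth of `det C` and decay of `C⁻¹` -/

section Growth

open scoped Matrix.Norms.Operator

variable {N : ℕ} {A B : Matrix (Fin N) (Fin N) ℝ}

/-- Conjugation bound: if the form of `M` dominates `a` times that of `X` at `Gᵀw`, then the form of
`M⁻¹` at `Gv` is at most `a⁻¹` times that of `X⁻¹` at `v`. -/
lemma inv_form_mulVec_le {M X G : Matrix (Fin N) (Fin N) ℝ} {a : ℝ} (ha : 0 < a) (hM : M.PosDef)
    (hX : X.PosDef) (h : ∀ w, a * ((Gᵀ *ᵥ w) ⬝ᵥ X *ᵥ (Gᵀ *ᵥ w)) ≤ w ⬝ᵥ M *ᵥ w) (v : Fin N → ℝ) :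
    (G *ᵥ v) ⬝ᵥ M⁻¹ *ᵥ (G *ᵥ v) ≤ a⁻¹ * (v ⬝ᵥ X⁻¹ *ᵥ v) := by
  refine inv_form_le hM fun w => ?_
  have h1 := two_mul_dotProduct_le hX v (a • (Gᵀ *ᵥ w))
  rw [mulVec_smul, dotProduct_smul, smul_dotProduct, dotProduct_smul, smul_eq_mul, smul_eq_mul,
    smul_eq_mul] at h1
  have h2 : (G *ᵥ v) ⬝ᵥ w = v ⬝ᵥ (Gᵀ *ᵥ w) := by
    rw [dotProduct_comm, dotProduct_mulVec, ← mulVec_transpose, dotProduct_comm]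
  rw [h2]
  have h3 : a⁻¹ * (2 * (a * (v ⬝ᵥ (Gᵀ *ᵥ w)))) ≤
      a⁻¹ * (v ⬝ᵥ X⁻¹ *ᵥ v + a * (a * ((Gᵀ *ᵥ w) ⬝ᵥ X *ᵥ (Gᵀ *ᵥ w)))) := by gcongr
  have e1 : a⁻¹ * (2 * (a * (v ⬝ᵥ (Gᵀ *ᵥ w)))) = 2 * (v ⬝ᵥ (Gᵀ *ᵥ w)) := by field_simp
  have e2 : a⁻¹ * (v ⬝ᵥ X⁻¹ *ᵥ v + a * (a * ((Gᵀ *ᵥ w) ⬝ᵥ X *ᵥ (Gᵀ *ᵥ w)))) =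
      a⁻¹ * (v ⬝ᵥ X⁻¹ *ᵥ v) + a * ((Gᵀ *ᵥ w) ⬝ᵥ X *ᵥ (Gᵀ *ᵥ w)) := by field_simp
  rw [e1, e2] at h3
  linarith [h w]

/-- Subadditivity of `(M, v) ↦ ⟨M⁻¹v, v⟩`. -/
lemma inv_form_mulVec_add_le {M X Y G : Matrix (Fin N) (Fin N) ℝ} (hM : M.PosDef)
    (hX : X.PosDef) (hY : Y.PosDef)
    (h : ∀ w, (Gᵀ *ᵥ w) ⬝ᵥ X *ᵥ (Gᵀ *ᵥ w) + w ⬝ᵥ Y *ᵥ w ≤ w ⬝ᵥ M *ᵥ w) (v b : Fin N → ℝ) :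
    (G *ᵥ v + b) ⬝ᵥ M⁻¹ *ᵥ (G *ᵥ v + b) ≤ v ⬝ᵥ X⁻¹ *ᵥ v + b ⬝ᵥ Y⁻¹ *ᵥ b := by
  refine inv_form_le hM fun w => ?_
  have h1 := two_mul_dotProduct_le hX v (Gᵀ *ᵥ w)
  have h2 := two_mul_dotProduct_le hY b w
  have h3 : (G *ᵥ v) ⬝ᵥ w = v ⬝ᵥ (Gᵀ *ᵥ w) := by
    rw [dotProduct_comm, dotProduct_mulVec, ← mulVec_transpose, dotProduct_comm]
  rw [add_dotProduct, h3]
  linarith [h w]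

lemma norm_entry_le (M : Matrix (Fin N) (Fin N) ℝ) (i j : Fin N) : ‖M i j‖ ≤ ‖M‖ := by
  rw [linfty_opNorm_def, ← coe_nnnorm, NNReal.coe_le_coe]
  exact (Finset.single_le_sum (f := fun j => ‖M i j‖₊) (fun _ _ => zero_le)
    (Finset.mem_univ j)).trans
      (Finset.le_sup (f := fun i => ∑ j, ‖M i j‖₊) (Finset.mem_univ i))

/-- Subexponential growth of `det C`, summing `C(k + 1) = C(k) + E(k) C(1) E(k)ᵀ`. -/
lemma exists_det_C_le (hB : ∀ μ ∈ spectrum ℂ (B.map (fun r : ℝ => (r : ℂ))), μ.re = 0)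
    {ρ : ℝ} (hρ : 1 < ρ) :
    ∃ c : ℝ, 0 < c ∧ ∀ k : ℕ, |(C A B k).det| ≤ c * (ρ ^ (3 * N)) ^ k := by
  obtain ⟨c, hc, hE⟩ := exists_norm_E_le hB hρ
  set d := c * ‖C A B 1‖ * (N * c) with hd
  have hd0 : 0 ≤ d := by positivity
  have hρ0 : 0 < ρ := by linarith
  have hT : ∀ M : Matrix (Fin N) (Fin N) ℝ, ‖Mᵀ‖ ≤ N * ‖M‖ := by
    intro M
    have : ‖Mᵀ‖₊ ≤ N * ‖M‖₊ := by
      rw [linfty_opNNNorm_def]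
      refine Finset.sup_le fun i _ => ?_
      refine (Finset.sum_le_card_nsmul _ _ ‖M‖₊ fun j _ => norm_entry_le M j i).trans ?_
      simp
    exact_mod_cast this
  have hsum : ∀ k : ℕ, ‖C A B k‖ ≤ d * k * (ρ ^ 2) ^ k := by
    intro k
    induction k with
    | zero => simp [C_zero]
    | succ k ih =>
      have h1 : ‖E B k * C A B 1 * (E B k)ᵀ‖ ≤ d * (ρ ^ 2) ^ k := by
        calc ‖E B k * C A B 1 * (E B k)ᵀ‖ ≤ ‖E B k‖ * ‖C A B 1‖ * ‖(E B k)ᵀ‖ :=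
              (norm_mul_le _ _).trans (by gcongr; exact norm_mul_le _ _)
          _ ≤ (c * ρ ^ k) * ‖C A B 1‖ * (N * (c * ρ ^ k)) := by
              gcongr
              · exact hE k
              · exact (hT _).trans (by gcongr; exact hE k)
          _ = d * (ρ ^ 2) ^ k := by rw [hd, ← pow_mul, mul_comm 2 k, pow_mul]; ring
      have h2 : (ρ ^ 2) ^ k ≤ (ρ ^ 2) ^ (k + 1) :=
        pow_le_pow_right₀ (one_le_pow₀ hρ.le) (Nat.le_succ k)
      push_cast
      rw [C_add]
      calc _ ≤ d * k * (ρ ^ 2) ^ k + d * (ρ ^ 2) ^ k := (norm_add_le _ _).trans (add_le_add ih h1)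
        _ = d * (k + 1) * (ρ ^ 2) ^ k := by ring
        _ ≤ _ := by gcongr
  have hk : ∀ k : ℕ, (k : ℝ) ≤ (ρ - 1)⁻¹ * ρ ^ k := by
    intro k
    have := one_add_mul_sub_le_pow (by linarith : (-1 : ℝ) ≤ ρ) k
    rw [le_inv_mul_iff₀ (by linarith)]
    linarith
  refine ⟨N.factorial * (d * (ρ - 1)⁻¹ + 1) ^ N, ?_, fun k => ?_⟩
  · have : 0 ≤ (ρ - 1)⁻¹ := inv_nonneg.2 (by linarith)
    positivity
  have hinv : 0 ≤ (ρ - 1)⁻¹ := inv_nonneg.2 (by linarith)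
  have hCk : ‖C A B k‖ ≤ (d * (ρ - 1)⁻¹ + 1) * (ρ ^ 3) ^ k := by
    calc _ ≤ d * k * (ρ ^ 2) ^ k := hsum k
      _ ≤ d * ((ρ - 1)⁻¹ * ρ ^ k) * (ρ ^ 2) ^ k := by gcongr; exact hk k
      _ = d * (ρ - 1)⁻¹ * (ρ ^ 3) ^ k := by
        rw [← pow_mul, ← pow_mul]; ring
      _ ≤ _ := by gcongr; linarith
  have hent : ∀ i j, |C A B k i j| ≤ (d * (ρ - 1)⁻¹ + 1) * (ρ ^ 3) ^ k := fun i j =>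
    (norm_entry_le _ i j).trans hCk
  have := det_le (abv := (AbsoluteValue.abs : AbsoluteValue ℝ ℝ)) hent
  simp only [AbsoluteValue.abs_apply, Fintype.card_fin, nsmul_eq_mul] at this
  refine this.trans_eq ?_
  rw [mul_pow, ← pow_mul, ← pow_mul, ← pow_mul]
  ring

/-- Since `det C` grows subexponentially, it cannot keep growing by a fixed factor: along any
arithmetic progression some ratio of consecutive values is at most `1 + η`. -/
lemma exists_det_C_ratio_le (hC : ∀ t : ℝ, 0 < t → (C A B t).PosDef)
    (hB : ∀ μ ∈ spectrum ℂ (B.map (fun r : ℝ => (r : ℂ))), μ.re = 0)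
    {n : ℕ} (hn : 0 < n) {η : ℝ} (hη : 0 < η) :
    ∃ k : ℕ, 0 < k ∧ (C A B ((n * k : ℕ) + n)).det ≤ (1 + η) * (C A B (n * k : ℕ)).det := by
  by_contra! hcon
  set m := 3 * N * n with hm
  set ρ := (1 + η) ^ ((m + 1 : ℕ) : ℝ)⁻¹ with hρ
  have hρ1 : 1 < ρ := Real.one_lt_rpow (by linarith) (by positivity)
  have hρm : ρ ^ (m + 1) = 1 + η := Real.rpow_inv_natCast_pow (by linarith) (by omega)
  obtain ⟨c, hc, hdet⟩ := exists_det_C_le (A := A) hB hρ1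
  have hpos : ∀ k : ℕ, 0 < k → 0 < (C A B (n * k : ℕ)).det := fun k hk =>
    (hC _ (by positivity)).det_pos
  have hgrow : ∀ j : ℕ, (1 + η) ^ j * (C A B (n * 1 : ℕ)).det ≤ (C A B (n * (j + 1) : ℕ)).det := by
    intro j
    induction j with
    | zero => simp
    | succ j ih =>
      have h1 := hcon (j + 1) (by omega)
      have e : ((n * (j + 1) : ℕ) : ℝ) + n = (n * (j + 1 + 1) : ℕ) := by push_cast; ring
      rw [e] at h1
      calc _ = (1 + η) * ((1 + η) ^ j * (C A B (n * 1 : ℕ)).det) := by ring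
        _ ≤ (1 + η) * (C A B (n * (j + 1) : ℕ)).det := by gcongr
        _ ≤ _ := h1.le
  have h1 := hpos 1 one_pos
  have hbound : ∀ j : ℕ, ρ ^ j ≤ c * ρ ^ m / (C A B (n * 1 : ℕ)).det := by
    intro j
    have h2 := (hgrow j).trans ((le_abs_self _).trans (hdet _))
    have e1 : (ρ ^ (3 * N)) ^ (n * (j + 1)) = ρ ^ m * (ρ ^ m) ^ j := by
      rw [hm, ← pow_mul, ← pow_mul, ← pow_add]; ring_nf
    have e2 : (1 + η) ^ j = (ρ ^ m) ^ j * ρ ^ j := by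
      rw [← hρm, ← mul_pow, pow_succ]
    rw [e1, e2] at h2
    rw [le_div_iff₀ h1]
    have h3 : 0 < (ρ ^ m) ^ j := by positivity
    refine le_of_mul_le_mul_left ?_ h3
    linarith
  obtain ⟨j, hj⟩ := ((tendsto_pow_atTop_atTop_of_one_lt hρ1).eventually_gt_atTop
    (c * ρ ^ m / (C A B (n * 1 : ℕ)).det)).exists
  exact absurd (hbound j) (not_le.2 hj)

lemma exists_det_C_ratio_le_two (hC : ∀ t : ℝ, 0 < t → (C A B t).PosDef)
    (hB : ∀ μ ∈ spectrum ℂ (B.map (fun r : ℝ => (r : ℂ))), μ.re = 0) {h : ℝ} (hh : 0 ≤ h) :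
    ∃ T : ℝ, 0 < T ∧ (C A B (T + h)).det ≤ 2 * (C A B T).det := by
  obtain ⟨k, hk, hle⟩ := exists_det_C_ratio_le hC hB (Nat.succ_pos ⌈h⌉₊) one_pos
  have hT : (0 : ℝ) < ((⌈h⌉₊ + 1) * k : ℕ) := by positivity
  refine ⟨_, hT, (det_C_mono hC (by linarith) ?_).trans (hle.trans_eq (by norm_num))⟩
  push_cast
  linarith [Nat.le_ceil h]

lemma sq_dotProduct_le (x y : Fin N → ℝ) : (x ⬝ᵥ y) ^ 2 ≤ (x ⬝ᵥ x) * (y ⬝ᵥ y) := by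
  simpa [dotProduct, sq] using Finset.sum_mul_sq_le_sq_mul_sq Finset.univ x y

/-- A large value of `⟨X⁻¹v, v⟩` at `v = Gx` would make the determinant of `X` jump when a matrix
bounded below by `G Gᵀ` is added. -/
lemma inv_form_le_of_det_add_le {X Y G : Matrix (Fin N) (Fin N) ℝ} {lam η : ℝ} (hX : X.PosDef)
    (hY : Y.IsHermitian) (hlam : 0 < lam)
    (h : ∀ w, lam * ((Gᵀ *ᵥ w) ⬝ᵥ (Gᵀ *ᵥ w)) ≤ w ⬝ᵥ Y *ᵥ w) (x : Fin N → ℝ)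
    (hdet : (X + Y).det ≤ (1 + η * (lam / (x ⬝ᵥ x + 1))) * X.det) :
    (G *ᵥ x) ⬝ᵥ X⁻¹ *ᵥ (G *ᵥ x) ≤ η := by
  have hx : 0 ≤ x ⬝ᵥ x := by simpa using dotProduct_star_self_nonneg x
  set a := lam / (x ⬝ᵥ x + 1) with ha
  have ha0 : 0 < a := by positivity
  have hax : a * (x ⬝ᵥ x) ≤ lam := by
    rw [ha, div_mul_eq_mul_div, div_le_iff₀ (by positivity)]
    nlinarith
  have hv : ∀ w, ((√a • (G *ᵥ x)) ⬝ᵥ w) ^ 2 ≤ w ⬝ᵥ Y *ᵥ w := by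
    intro w
    have h2 : (G *ᵥ x) ⬝ᵥ w = x ⬝ᵥ (Gᵀ *ᵥ w) := by
      rw [dotProduct_comm, dotProduct_mulVec, ← mulVec_transpose, dotProduct_comm]
    have hw : 0 ≤ (Gᵀ *ᵥ w) ⬝ᵥ (Gᵀ *ᵥ w) := by simpa using dotProduct_star_self_nonneg (Gᵀ *ᵥ w)
    rw [smul_dotProduct, smul_eq_mul, mul_pow, Real.sq_sqrt ha0.le, h2]
    calc _ ≤ a * ((x ⬝ᵥ x) * ((Gᵀ *ᵥ w) ⬝ᵥ (Gᵀ *ᵥ w))) := by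
          gcongr; exact sq_dotProduct_le _ _
      _ = a * (x ⬝ᵥ x) * ((Gᵀ *ᵥ w) ⬝ᵥ (Gᵀ *ᵥ w)) := by ring
      _ ≤ lam * ((Gᵀ *ᵥ w) ⬝ᵥ (Gᵀ *ᵥ w)) := by gcongr
      _ ≤ _ := h w
  have h1 := (det_mul_one_add_inv_form_le hX hY hv).trans hdet
  rw [mul_comm] at h1
  have h2 := le_of_mul_le_mul_right h1 hX.det_pos
  rw [mulVec_smul, dotProduct_smul, smul_dotProduct, smul_eq_mul, smul_eq_mul, ← mul_assoc,
    Real.mul_self_sqrt ha0.le] at h2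
  have h3 : a * ((G *ᵥ x) ⬝ᵥ X⁻¹ *ᵥ (G *ᵥ x)) ≤ a * η := by linarith
  exact le_of_mul_le_mul_left h3 ha0

/-- As `C(k)` and its transport by `E(1)` have the same determinant, the ratio `det C(1 + k) / det C(k)`
measures the effect of adding `C(1)` to `E(1) C(k) E(1)ᵀ`. -/
lemma eventually_inv_form_C_le (hC : ∀ t : ℝ, 0 < t → (C A B t).PosDef)
    (hB : ∀ μ ∈ spectrum ℂ (B.map (fun r : ℝ => (r : ℂ))), μ.re = 0) (x : Fin N → ℝ)
    {η : ℝ} (hη : 0 < η) : ∀ᶠ h : ℝ in atTop, x ⬝ᵥ (C A B h)⁻¹ *ᵥ x ≤ η := by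
  have hC1 := hC 1 one_pos
  obtain ⟨lam, hlam, hl⟩ := exists_pos_mul_le_form hC1
  have hx : 0 ≤ x ⬝ᵥ x := by simpa using dotProduct_star_self_nonneg x
  obtain ⟨k, hk, hdet⟩ := exists_det_C_ratio_le hC hB one_pos
    (show 0 < η * (lam / (x ⬝ᵥ x + 1)) by positivity)
  simp only [one_mul, Nat.cast_one] at hdet
  have hk0 : (0 : ℝ) < k := by positivity
  set X := E B 1 * C A B k * (E B 1)ᵀ with hX
  have hE : (E B 1).det = 1 := det_E (trace_eq_zero hB) 1
  have hXdet : X.det = (C A B k).det := by simp [hX, det_mul, hE]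
  have hXsd : X.PosSemidef := by
    simpa [conjTranspose_eq_transpose_of_trivial] using
      (hC k hk0).posSemidef.mul_mul_conjTranspose_same (E B 1)
  have hXpd : X.PosDef := hXsd.posDef_iff_det_ne_zero.2 (by rw [hXdet]; exact (hC k hk0).det_pos.ne')
  have h1 : x ⬝ᵥ X⁻¹ *ᵥ x ≤ η := by
    have := inv_form_le_of_det_add_le (G := 1) (η := η) hXpd hC1.1 hlam (by simpa using hl) x (by
      rw [add_comm X, hX, ← C_add, ← hX, hXdet, add_comm (1 : ℝ) (k : ℝ)]; exact hdet)
    simpa using this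
  filter_upwards [eventually_ge_atTop (1 + k : ℝ)] with h hh
  refine (inv_form_le (hC h (by linarith)) fun w => ?_).trans h1
  have h2 := two_mul_dotProduct_le hXpd x w
  have h3 := C_form_mono hC hh w
  rw [C_add, add_mulVec, dotProduct_add] at h3
  linarith [form_nonneg hC1.posSemidef w]

/-- Here the ratio `det C(k + 1) / det C(k)` measures the effect of adding `E(k) C(1) E(k)ᵀ` to
`C(k)`. The form is nonincreasing in time, which passes from one `k` to all later times. -/
lemma eventually_inv_form_C_E_le (hC : ∀ t : ℝ, 0 < t → (C A B t).PosDef)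
    (hB : ∀ μ ∈ spectrum ℂ (B.map (fun r : ℝ => (r : ℂ))), μ.re = 0) (x : Fin N → ℝ)
    {η : ℝ} (hη : 0 < η) :
    ∀ᶠ h : ℝ in atTop, (E B h *ᵥ x) ⬝ᵥ (C A B h)⁻¹ *ᵥ (E B h *ᵥ x) ≤ η := by
  have hC1 := hC 1 one_pos
  obtain ⟨lam, hlam, hl⟩ := exists_pos_mul_le_form hC1
  have hx : 0 ≤ x ⬝ᵥ x := by simpa using dotProduct_star_self_nonneg x
  obtain ⟨k, hk, hdet⟩ := exists_det_C_ratio_le hC hB one_pos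
    (show 0 < η * (lam / (x ⬝ᵥ x + 1)) by positivity)
  simp only [one_mul, Nat.cast_one] at hdet
  have hk0 : (0 : ℝ) < k := by positivity
  have hY : ∀ w, w ⬝ᵥ (E B k * C A B 1 * (E B k)ᵀ) *ᵥ w =
      ((E B k)ᵀ *ᵥ w) ⬝ᵥ C A B 1 *ᵥ ((E B k)ᵀ *ᵥ w) := fun w => by
    rw [← mulVec_mulVec, ← mulVec_mulVec, dotProduct_mulVec w (E B k), ← mulVec_transpose (E B k) w]
  have hYh : (E B k * C A B 1 * (E B k)ᵀ).IsHermitian := by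
    simpa [conjTranspose_eq_transpose_of_trivial] using
      (hC1.posSemidef.mul_mul_conjTranspose_same (E B k)).1
  have h1 : (E B k *ᵥ x) ⬝ᵥ (C A B k)⁻¹ *ᵥ (E B k *ᵥ x) ≤ η :=
    inv_form_le_of_det_add_le (hC k hk0) hYh hlam (fun w => by rw [hY]; exact hl _) x
      (by rw [← C_add]; exact hdet)
  filter_upwards [eventually_ge_atTop (k : ℝ)] with h hh
  have e : E B h *ᵥ x = E B (h - k) *ᵥ (E B k *ᵥ x) := by
    rw [mulVec_mulVec, ← E_add, sub_add_cancel]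
  rw [e]
  refine (inv_form_mulVec_le one_pos (hC h (by linarith)) (hC k hk0) (fun w => ?_) _).trans
    (by simpa using h1)
  have h2 := C_form_add A B (h - k) k w
  rw [sub_add_cancel] at h2
  rw [h2, one_mul]
  linarith [form_nonneg (posSemidef_C hC (sub_nonneg.2 hh)) w]

end Growth

/-! ### The adjoint of the operator and the chain rule -/

section Adjoint

open MeasureTheory

variable {N : ℕ} {A B : Matrix (Fin N) (Fin N) ℝ}

local notation "𝕍" => EuclideanSpace ℝ (Fin N)

/-- The partial derivative `∂ᵢ v`. -/
noncomputable def pderiv (i : Fin N) (v : 𝕍 → ℝ) (x : 𝕍) : ℝ := fderiv ℝ v x (EuclideanSpace.single i 1)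

lemma fderiv_eq_sum_pderiv (v : 𝕍 → ℝ) (x h : 𝕍) :
    fderiv ℝ v x h = ∑ i, h i * pderiv i v x := by
  have hh : h = ∑ i, h i • EuclideanSpace.single i (1 : ℝ) := by
    simpa using ((EuclideanSpace.basisFun (Fin N) ℝ).sum_repr h).symm
  conv_lhs => rw [hh]
  simp [pderiv]

lemma L_eq (A B : Matrix (Fin N) (Fin N) ℝ) (v : 𝕍 → ℝ) (x : 𝕍) :
    L A B v x = ∑ i, ∑ j, A i j * pderiv j (pderiv i v) x +
      ∑ i, (B *ᵥ x.ofLp) i * pderiv i v x := by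
  rw [L]
  congr 1
  have : inner ℝ (WithLp.toLp 2 (B *ᵥ x.ofLp)) (gradient v x) =
      fderiv ℝ v x (WithLp.toLp 2 (B *ᵥ x.ofLp)) := by
    rw [real_inner_comm, gradient, InnerProductSpace.toDual_symm_apply]
  rw [this, fderiv_eq_sum_pderiv]

lemma contDiff_pderiv {n m : WithTop ℕ∞} {v : 𝕍 → ℝ} (hv : ContDiff ℝ n v) (hmn : m + 1 ≤ n)
    (i : Fin N) : ContDiff ℝ m (pderiv i v) :=
  (hv.fderiv_right hmn).clm_apply contDiff_const

lemma hasCompactSupport_pderiv {v : 𝕍 → ℝ} (hv : HasCompactSupport v) (i : Fin N) :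
    HasCompactSupport (pderiv i v) := hv.fderiv_apply ℝ _

lemma integral_pderiv_mul {f g : 𝕍 → ℝ} (hf : ContDiff ℝ 1 f) (hg : ContDiff ℝ 1 g)
    (hgc : HasCompactSupport g) (i : Fin N) :
    ∫ x, pderiv i f x * g x = -∫ x, f x * pderiv i g x := by
  have hf' : Continuous (pderiv i f) :=
    (contDiff_pderiv (m := 0) hf (by norm_num) i).continuous
  have hg' : Continuous (pderiv i g) :=
    (contDiff_pderiv (m := 0) hg (by norm_num) i).continuous
  have := integral_mul_fderiv_eq_neg_fderiv_mul_of_integrable (μ := (volume : Measure 𝕍))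
    (f := f) (g := g) (v := EuclideanSpace.single i 1)
    ((hf'.mul hg.continuous).integrable_of_hasCompactSupport hgc.mul_left)
    ((hf.continuous.mul hg').integrable_of_hasCompactSupport
      (hasCompactSupport_pderiv hgc i).mul_left)
    ((hf.continuous.mul hg.continuous).integrable_of_hasCompactSupport hgc.mul_left)
    (fun x _ => hf.differentiable one_ne_zero x) (fun x _ => hg.differentiable one_ne_zero x)
  simp only [pderiv]
  rw [this, neg_neg]

lemma pderiv_mul {f g : 𝕍 → ℝ} {x : 𝕍} (hf : DifferentiableAt ℝ f x)
    (hg : DifferentiableAt ℝ g x) (i : Fin N) :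
    pderiv i (fun y => f y * g y) x = pderiv i f x * g x + f x * pderiv i g x := by
  rw [pderiv, fderiv_fun_mul hf hg]
  simp [pderiv]
  ring

lemma contDiff_mulVec_apply (B : Matrix (Fin N) (Fin N) ℝ) (i : Fin N) {n : WithTop ℕ∞} :
    ContDiff ℝ n (fun x : 𝕍 => (B *ᵥ x.ofLp) i) := by
  simp only [mulVec, dotProduct]
  fun_prop

lemma pderiv_mulVec_apply (B : Matrix (Fin N) (Fin N) ℝ) (i j : Fin N) (x : 𝕍) :
    pderiv j (fun x : 𝕍 => (B *ᵥ x.ofLp) i) x = B i j := by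
  let l : 𝕍 →L[ℝ] ℝ := ∑ k, B i k • EuclideanSpace.proj k
  have : (fun x : 𝕍 => (B *ᵥ x.ofLp) i) = l := by
    ext x; simp [l, mulVec, dotProduct]
  rw [pderiv, this, ContinuousLinearMap.fderiv]
  simp [l]

/-- Green's identity: as `B` has trace zero, the formal adjoint of `L A B` is `L A (-B)`. -/
lemma integral_L_mul (hA : A.IsHermitian) (hB : B.trace = 0) {w F : 𝕍 → ℝ} (hw : ContDiff ℝ 2 w)
    (hF : ContDiff ℝ 2 F) (hFc : HasCompactSupport F) :
    ∫ x, L A B w x * F x = ∫ x, w x * L A (-B) F x := by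
  have hw1 : ContDiff ℝ 1 w := hw.of_le (by norm_num)
  have hF1 : ContDiff ℝ 1 F := hF.of_le (by norm_num)
  have hwi : ∀ i, ContDiff ℝ 1 (pderiv i w) := contDiff_pderiv hw (by norm_num)
  have hFi : ∀ i, ContDiff ℝ 1 (pderiv i F) := contDiff_pderiv hF (by norm_num)
  have hwij : ∀ i j, Continuous (pderiv j (pderiv i w)) := fun i j =>
    (contDiff_pderiv (m := 0) (hwi i) (by norm_num) j).continuous
  have hFij : ∀ i j, Continuous (pderiv j (pderiv i F)) := fun i j =>
    (contDiff_pderiv (m := 0) (hFi i) (by norm_num) j).continuous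
  have hFic : ∀ i, HasCompactSupport (pderiv i F) := hasCompactSupport_pderiv hFc
  have hFijc : ∀ i j, HasCompactSupport (pderiv j (pderiv i F)) := fun i =>
    hasCompactSupport_pderiv (hFic i)
  have hlin : ∀ i, ContDiff ℝ 1 (fun x : 𝕍 => (B *ᵥ x.ofLp) i) := fun i => contDiff_mulVec_apply B i
  have h2 : ∀ i j, ∫ x, pderiv j (pderiv i w) x * F x = ∫ x, w x * pderiv i (pderiv j F) x := by
    intro i j
    rw [integral_pderiv_mul (hwi i) hF1 hFc, integral_pderiv_mul hw1 (hFi j) (hFic j), neg_neg]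
  have h1 : ∀ i, ∫ x : 𝕍, (B *ᵥ x.ofLp) i * pderiv i w x * F x =
      -∫ x, w x * (B i i * F x + (B *ᵥ x.ofLp) i * pderiv i F x) := by
    intro i
    have := integral_pderiv_mul hw1 ((hlin i).mul hF1) hFc.mul_left i
    simp_rw [pderiv_mul ((hlin i).differentiable one_ne_zero _)
      (hF1.differentiable one_ne_zero _), pderiv_mulVec_apply] at this
    rw [← this]
    congr 1; ext x; ring
  have int2 : ∀ i j, Integrable fun x => A i j * (pderiv j (pderiv i w) x * F x) := fun i j =>
    (((hwij i j).mul hF.continuous).integrable_of_hasCompactSupport hFc.mul_left).const_mul _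
  have int1 : ∀ i, Integrable fun x : 𝕍 => (B *ᵥ x.ofLp) i * pderiv i w x * F x := fun i =>
    (((hlin i).continuous.mul (hwi i).continuous).mul
      hF.continuous).integrable_of_hasCompactSupport hFc.mul_left
  have int2' : ∀ i j, Integrable fun x => A i j * (w x * pderiv i (pderiv j F) x) := fun i j =>
    ((hw.continuous.mul (hFij j i)).integrable_of_hasCompactSupport
      (hFijc j i).mul_left).const_mul _
  have int0' : ∀ i, Integrable fun x : 𝕍 => w x * (B i i * F x) := fun i =>
    (hw.continuous.mul (continuous_const.mul hF.continuous)).integrable_of_hasCompactSupport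
      (hFc.mul_left.mul_left)
  have int1' : ∀ i, Integrable fun x : 𝕍 => w x * ((B *ᵥ x.ofLp) i * pderiv i F x) := fun i =>
    (hw.continuous.mul ((hlin i).continuous.mul (hFi i).continuous)).integrable_of_hasCompactSupport
      ((hFic i).mul_left.mul_left)
  have lhs : ∫ x, L A B w x * F x = (∑ i, ∑ j, A i j * ∫ x, w x * pderiv i (pderiv j F) x) -
      ∑ i, ∫ x : 𝕍, w x * ((B *ᵥ x.ofLp) i * pderiv i F x) := by
    have e : ∀ x : 𝕍, L A B w x * F x = ∑ i, ∑ j, A i j * (pderiv j (pderiv i w) x * F x) +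
        ∑ i, (B *ᵥ x.ofLp) i * pderiv i w x * F x := fun x => by
      rw [L_eq, add_mul, Finset.sum_mul, Finset.sum_mul]
      simp_rw [Finset.sum_mul, mul_assoc]
    simp_rw [e]
    rw [integral_add (integrable_finsetSum _ fun i _ => integrable_finsetSum _ fun j _ => int2 i j)
      (integrable_finsetSum _ fun i _ => int1 i),
      integral_finsetSum _ (fun i _ => integrable_finsetSum _ fun j _ => int2 i j),
      integral_finsetSum _ (fun i _ => int1 i), sub_eq_add_neg]
    congr 1
    · refine Finset.sum_congr rfl fun i _ => ?_
      rw [integral_finsetSum _ (fun j _ => int2 i j)]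
      refine Finset.sum_congr rfl fun j _ => ?_
      rw [integral_const_mul, h2]
    · have e3 : ∀ i, ∫ x : 𝕍, w x * (B i i * F x + (B *ᵥ x.ofLp) i * pderiv i F x) =
          B i i * (∫ x, w x * F x) + ∫ x : 𝕍, w x * ((B *ᵥ x.ofLp) i * pderiv i F x) := fun i => by
        simp_rw [mul_add]
        rw [integral_add (int0' i) (int1' i), ← integral_const_mul]
        congr 2; ext x; ring
      simp_rw [h1, e3]
      have : ∑ i, B i i = 0 := hB
      rw [Finset.sum_neg_distrib, Finset.sum_add_distrib, ← Finset.sum_mul, this, zero_mul, zero_add]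
  have rhs : ∫ x, w x * L A (-B) F x = (∑ i, ∑ j, A i j * ∫ x, w x * pderiv j (pderiv i F) x) -
      ∑ i, ∫ x : 𝕍, w x * ((B *ᵥ x.ofLp) i * pderiv i F x) := by
    have e : ∀ x : 𝕍, w x * L A (-B) F x = ∑ i, ∑ j, A i j * (w x * pderiv j (pderiv i F) x) -
        ∑ i, w x * ((B *ᵥ x.ofLp) i * pderiv i F x) := fun x => by
      rw [L_eq, mul_add, Finset.mul_sum, Finset.mul_sum, sub_eq_add_neg, ← Finset.sum_neg_distrib]
      simp_rw [Finset.mul_sum, neg_mulVec, Pi.neg_apply]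
      congr 1
      · exact Finset.sum_congr rfl fun i _ => Finset.sum_congr rfl fun j _ => by ring
      · exact Finset.sum_congr rfl fun i _ => by ring
    have hAs : ∀ i j, A j i = A i j := fun i j => by simpa using hA.apply i j
    have int2'' : ∀ i j, Integrable fun x => A i j * (w x * pderiv j (pderiv i F) x) := fun i j =>
      hAs i j ▸ int2' j i
    simp_rw [e]
    rw [integral_sub (integrable_finsetSum _ fun i _ => integrable_finsetSum _ fun j _ => int2'' i j)
      (integrable_finsetSum _ fun i _ => int1' i),
      integral_finsetSum _ (fun i _ => integrable_finsetSum _ fun j _ => int2'' i j),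
      integral_finsetSum _ (fun i _ => int1' i)]
    congr 1
    refine Finset.sum_congr rfl fun i _ => ?_
    rw [integral_finsetSum _ (fun j _ => int2'' i j)]
    exact Finset.sum_congr rfl fun j _ => integral_const_mul _ _
  rw [lhs, rhs]
  congr 1
  rw [Finset.sum_comm]
  refine Finset.sum_congr rfl fun i _ => Finset.sum_congr rfl fun j _ => ?_
  have : A j i = A i j := by simpa using hA.apply i j
  rw [this]

/-- The gradient as a vector of partial derivatives. -/
noncomputable def grad (v : 𝕍 → ℝ) (x : 𝕍) : Fin N → ℝ := fun i => pderiv i v x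

lemma pderiv_comp {φ : ℝ → ℝ} {φ' : ℝ} {ψ : 𝕍 → ℝ} {x : 𝕍} (hφ : HasDerivAt φ φ' (ψ x))
    (hψ : DifferentiableAt ℝ ψ x) (i : Fin N) :
    pderiv i (fun y => φ (ψ y)) x = φ' * pderiv i ψ x := by
  have := (hφ.comp_hasFDerivAt x hψ.hasFDerivAt).fderiv
  rw [pderiv, show (fun y => φ (ψ y)) = φ ∘ ψ from rfl, this]
  simp [pderiv]

/-- The chain rule for the second-order operator `L`. -/
lemma L_comp (A B : Matrix (Fin N) (Fin N) ℝ) {φ φ' φ'' : ℝ → ℝ}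
    (h1 : ∀ s, HasDerivAt φ (φ' s) s) (h2 : ∀ s, HasDerivAt φ' (φ'' s) s)
    {ψ : 𝕍 → ℝ} (hψ : ContDiff ℝ 2 ψ) (x : 𝕍) :
    L A B (fun y => φ (ψ y)) x =
      φ' (ψ x) * L A B ψ x + φ'' (ψ x) * (grad ψ x ⬝ᵥ A *ᵥ grad ψ x) := by
  have hd : Differentiable ℝ ψ := hψ.differentiable (by norm_num)
  have hdi : ∀ i, Differentiable ℝ (pderiv i ψ) := fun i =>
    (contDiff_pderiv (m := 1) hψ (by norm_num) i).differentiable one_ne_zero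
  have e1 : ∀ i, pderiv i (fun y => φ (ψ y)) = fun y => φ' (ψ y) * pderiv i ψ y := fun i => by
    ext y; exact pderiv_comp (h1 _) (hd y) i
  have e2 : ∀ i j, pderiv j (fun y => φ' (ψ y) * pderiv i ψ y) x =
      φ'' (ψ x) * pderiv j ψ x * pderiv i ψ x + φ' (ψ x) * pderiv j (pderiv i ψ) x := fun i j => by
    have hc : DifferentiableAt ℝ (fun y => φ' (ψ y)) x :=
      ((h2 _).comp_hasFDerivAt x (hd x).hasFDerivAt).differentiableAt
    rw [pderiv_mul hc (hdi i x),
      pderiv_comp (h2 _) (hd x)]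
  rw [L_eq, L_eq]
  simp_rw [e1, e2]
  simp only [grad, dotProduct, mulVec, mul_add, Finset.mul_sum, Finset.sum_add_distrib]
  have e3 : ∑ i, ∑ j, A i j * (φ'' (ψ x) * pderiv j ψ x * pderiv i ψ x) =
      ∑ i, ∑ j, φ'' (ψ x) * (pderiv i ψ x * (A i j * pderiv j ψ x)) :=
    Finset.sum_congr rfl fun i _ => Finset.sum_congr rfl fun j _ => by ring
  have e4 : ∑ i, ∑ j, A i j * (φ' (ψ x) * pderiv j (pderiv i ψ) x) =
      ∑ i, ∑ j, φ' (ψ x) * (A i j * pderiv j (pderiv i ψ) x) :=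
    Finset.sum_congr rfl fun i _ => Finset.sum_congr rfl fun j _ => by ring
  have e5 : ∑ i, (∑ j, B i j * x.ofLp j) * (φ' (ψ x) * pderiv i ψ x) =
      ∑ i, φ' (ψ x) * ((∑ j, B i j * x.ofLp j) * pderiv i ψ x) :=
    Finset.sum_congr rfl fun i _ => by ring
  rw [e3, e4, e5]
  ring

end Adjoint

/-! ### A convex truncation of the exponential -/

section Truncation

lemma hasDerivAt_max_zero_pow (n : ℕ) (y : ℝ) :
    HasDerivAt (fun y : ℝ => max y 0 ^ (n + 2)) ((n + 2) * max y 0 ^ (n + 1)) y := by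
  rcases lt_trichotomy y 0 with hy | rfl | hy
  · have : (fun y : ℝ => max y 0 ^ (n + 2)) =ᶠ[𝓝 y] fun _ => 0 := by
      filter_upwards [gt_mem_nhds hy] with z hz
      simp [max_eq_right hz.le]
    simpa [max_eq_right hy.le] using (hasDerivAt_const y (0 : ℝ)).congr_of_eventuallyEq this
  · simp only [max_self, ne_eq, Nat.add_eq_zero_iff, one_ne_zero, and_false, not_false_eq_true,
      zero_pow, mul_zero]
    refine hasDerivAt_iff_isLittleO_nhds_zero.2 ?_
    have h : (fun h : ℝ => max h 0 ^ (n + 2)) =O[𝓝 0] fun h => h ^ (n + 2) := by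
      refine Asymptotics.IsBigO.of_bound 1 (Eventually.of_forall fun h => ?_)
      rw [one_mul, norm_pow, norm_pow]
      gcongr
      rcases le_total h 0 with hh | hh <;> simp [hh]
    simpa using h.trans_isLittleO (Asymptotics.isLittleO_pow_id (by omega))
  · have : (fun y : ℝ => max y 0 ^ (n + 2)) =ᶠ[𝓝 y] fun y => y ^ (n + 2) := by
      filter_upwards [lt_mem_nhds hy] with z hz
      simp [max_eq_left hz.le]
    rw [max_eq_left hy.le]
    simpa using (hasDerivAt_pow (n + 2) y).congr_of_eventuallyEq this

/-- The cutoff factor `(1 - e^{-k-s})₊`. -/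
noncomputable def cut (k s : ℝ) : ℝ := max (1 - Real.exp (-k - s)) 0

/-- A `C²` truncation of `s ↦ eˢ` that vanishes for `s ≤ -k`. As a function of `eˢ` it is convex,
which is the inequality `trunc₁ ≤ trunc₂` between its first two derivatives. -/
noncomputable def trunc (k s : ℝ) : ℝ := Real.exp s * cut k s ^ 3

/-- The derivative of `trunc`. -/
noncomputable def trunc₁ (k s : ℝ) : ℝ := Real.exp s * cut k s ^ 3 + 3 * Real.exp (-k) * cut k s ^ 2

/-- The second derivative of `trunc`. -/
noncomputable def trunc₂ (k s : ℝ) : ℝ := trunc₁ k s + 6 * Real.exp (-2 * k - s) * cut k s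

lemma cut_nonneg (k s : ℝ) : 0 ≤ cut k s := le_max_right _ _

lemma cut_le_one (k s : ℝ) : cut k s ≤ 1 :=
  max_le (by linarith [Real.exp_pos (-k - s)]) zero_le_one

lemma cut_eq_zero {k s : ℝ} (h : s ≤ -k) : cut k s = 0 := by
  refine max_eq_right ?_
  have : 1 ≤ Real.exp (-k - s) := Real.one_le_exp (by linarith)
  linarith

lemma continuous_cut : Continuous fun p : ℝ × ℝ => cut p.1 p.2 := by
  unfold cut; fun_prop

lemma hasDerivAt_cut_pow (k s : ℝ) (n : ℕ) :
    HasDerivAt (fun s => cut k s ^ (n + 2)) ((n + 2) * cut k s ^ (n + 1) * Real.exp (-k - s)) s := by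
  have h1 : HasDerivAt (fun s => 1 - Real.exp (-k - s)) (Real.exp (-k - s)) s := by
    have := (((hasDerivAt_id s).const_sub (-k)).exp).const_sub 1
    simpa using this
  exact (hasDerivAt_max_zero_pow n _).comp s h1

lemma hasDerivAt_trunc (k s : ℝ) : HasDerivAt (trunc k) (trunc₁ k s) s := by
  refine ((Real.hasDerivAt_exp s).mul (hasDerivAt_cut_pow k s 1)).congr_deriv ?_
  have : Real.exp (-k) = Real.exp s * Real.exp (-k - s) := by rw [← Real.exp_add]; ring_nf
  rw [trunc₁, this]
  push_cast
  ring

lemma hasDerivAt_trunc₁ (k s : ℝ) : HasDerivAt (trunc₁ k) (trunc₂ k s) s := by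
  refine ((hasDerivAt_trunc k s).add
    ((hasDerivAt_cut_pow k s 0).const_mul (3 * Real.exp (-k)))).congr_deriv ?_
  have : Real.exp (-2 * k - s) = Real.exp (-k) * Real.exp (-k - s) := by
    rw [← Real.exp_add]; ring_nf
  rw [trunc₂, this]
  push_cast
  ring

lemma continuous_trunc₁ (k : ℝ) : Continuous (trunc₁ k) :=
  continuous_iff_continuousAt.2 fun s => (hasDerivAt_trunc₁ k s).continuousAt

lemma continuous_trunc₂ (k : ℝ) : Continuous (trunc₂ k) := by
  have h : Continuous (cut k) := continuous_cut.comp (Continuous.prodMk_right k)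
  exact (continuous_trunc₁ k).add ((continuous_const.mul (by fun_prop)).mul h)

lemma contDiff_trunc (k : ℝ) : ContDiff ℝ 2 (trunc k) := by
  have h1 : deriv (trunc k) = trunc₁ k := funext fun s => (hasDerivAt_trunc k s).deriv
  have h2 : deriv (trunc₁ k) = trunc₂ k := funext fun s => (hasDerivAt_trunc₁ k s).deriv
  rw [show (2 : WithTop ℕ∞) = 1 + 1 by norm_num, contDiff_succ_iff_deriv]
  refine ⟨fun s => (hasDerivAt_trunc k s).differentiableAt, by simp, ?_⟩
  rw [h1, contDiff_one_iff_deriv, h2]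
  exact ⟨fun s => (hasDerivAt_trunc₁ k s).differentiableAt, continuous_trunc₂ k⟩

lemma trunc_nonneg (k s : ℝ) : 0 ≤ trunc k s :=
  mul_nonneg (Real.exp_pos s).le (pow_nonneg (cut_nonneg k s) 3)

lemma trunc_le_exp (k s : ℝ) : trunc k s ≤ Real.exp s :=
  mul_le_of_le_one_right (Real.exp_pos s).le (pow_le_one₀ (cut_nonneg k s) (cut_le_one k s))

lemma trunc_eq_zero {k s : ℝ} (h : s ≤ -k) : trunc k s = 0 := by simp [trunc, cut_eq_zero h]

lemma trunc₁_eq_zero {k s : ℝ} (h : s ≤ -k) : trunc₁ k s = 0 := by simp [trunc₁, cut_eq_zero h]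

lemma trunc₁_le_trunc₂ (k s : ℝ) : trunc₁ k s ≤ trunc₂ k s := by
  have := cut_nonneg k s
  rw [trunc₂]
  have : 0 ≤ 6 * Real.exp (-2 * k - s) * cut k s := by positivity
  linarith

lemma trunc₂_sub_trunc₁_le {δ : ℝ} (hδ : δ ≤ 2) (k s : ℝ) :
    trunc₂ k s - trunc₁ k s ≤ 6 * Real.exp (-δ * k) * Real.exp ((1 - δ) * s) := by
  rw [trunc₂, add_sub_cancel_left]
  rcases le_or_gt s (-k) with h | h
  · rw [cut_eq_zero h]; simp only [mul_zero]; positivity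
  · rw [mul_assoc, mul_assoc, ← Real.exp_add]
    have h1 : Real.exp (-2 * k - s) ≤ Real.exp (-δ * k + (1 - δ) * s) :=
      Real.exp_le_exp.2 (by nlinarith)
    have h2 : Real.exp (-2 * k - s) * cut k s ≤ Real.exp (-2 * k - s) :=
      mul_le_of_le_one_right (Real.exp_pos _).le (cut_le_one k s)
    linarith

lemma tendsto_trunc {ι : Type*} {l : Filter ι} {k s : ι → ℝ} {a : ℝ} (hk : Tendsto k l atTop)
    (hs : Tendsto s l (𝓝 a)) : Tendsto (fun i => trunc (k i) (s i)) l (𝓝 (Real.exp a)) := by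
  have h1 : Tendsto (fun i => Real.exp (-k i - s i)) l (𝓝 0) := by
    refine Real.tendsto_exp_atBot.comp ?_
    simpa [sub_eq_add_neg] using (tendsto_neg_atTop_atBot.comp hk).atBot_add hs.neg
  have h2 : Tendsto (fun i => cut (k i) (s i)) l (𝓝 1) := by
    simpa [cut] using (h1.const_sub 1).max (tendsto_const_nhds (x := (0 : ℝ)))
  simpa [trunc] using (Real.continuous_exp.continuousAt.tendsto.comp hs).mul (h2.pow 3)

end Truncation

/-! ### The logarithm of the Gaussian kernel -/

section Kernel

open scoped Matrix.Norms.Operator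

variable {N : ℕ} {A B : Matrix (Fin N) (Fin N) ℝ}

local notation "𝕍" => EuclideanSpace ℝ (Fin N)

lemma pderiv_sub_const (f : 𝕍 → ℝ) (c : ℝ) (i : Fin N) (z : 𝕍) :
    pderiv i (fun z => f z - c) z = pderiv i f z := by
  rw [pderiv, fderiv_sub_const, pderiv]

lemma pderiv_sum {f : Fin N → 𝕍 → ℝ} {z : 𝕍} (hf : ∀ k, DifferentiableAt ℝ (f k) z) (i : Fin N) :
    pderiv i (fun z => ∑ k, f k z) z = ∑ k, pderiv i (f k) z := by
  rw [pderiv, fderiv_fun_sum fun k _ => hf k]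
  simp [pderiv]

lemma contDiff_quadratic (P G : Matrix (Fin N) (Fin N) ℝ) (a : ℝ) (x : Fin N → ℝ) :
    ContDiff ℝ 2
      (fun z : 𝕍 => a - (G *ᵥ z.ofLp - x) ⬝ᵥ P *ᵥ (G *ᵥ z.ofLp - x) / 4) := by
  simp only [mulVec, dotProduct, Pi.sub_apply]
  fun_prop

lemma grad_quadratic {P G : Matrix (Fin N) (Fin N) ℝ} (hP : P.IsHermitian) (a : ℝ)
    (x : Fin N → ℝ) (z : 𝕍) :
    grad (fun z : 𝕍 => a - (G *ᵥ z.ofLp - x) ⬝ᵥ P *ᵥ (G *ᵥ z.ofLp - x) / 4) z =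
      (-1 / 2 : ℝ) • (Gᵀ *ᵥ P *ᵥ (G *ᵥ z.ofLp - x)) := by
  have hP' : Pᵀ = P := by simpa [IsHermitian, conjTranspose_eq_transpose_of_trivial] using hP
  have hlin : ∀ (Q : Matrix (Fin N) (Fin N) ℝ) (y : Fin N → ℝ) (k : Fin N),
      DifferentiableAt ℝ (fun z : 𝕍 => (Q *ᵥ z.ofLp) k - y k) z := fun Q y k =>
    (((contDiff_mulVec_apply Q k (n := 1)).differentiable one_ne_zero) z).sub_const _
  ext i
  have hS : DifferentiableAt ℝ (fun z : 𝕍 => ∑ k, ((G *ᵥ z.ofLp) k - x k) *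
      (((P * G) *ᵥ z.ofLp) k - (P *ᵥ x) k)) z :=
    DifferentiableAt.fun_sum fun k _ => (hlin _ _ _).mul (hlin _ _ _)
  have e : (fun z : 𝕍 => a - (G *ᵥ z.ofLp - x) ⬝ᵥ P *ᵥ (G *ᵥ z.ofLp - x) / 4) =
      fun z : 𝕍 => (fun s : ℝ => a - s / 4) (∑ k, ((G *ᵥ z.ofLp) k - x k) *
        (((P * G) *ᵥ z.ofLp) k - (P *ᵥ x) k)) := by
    ext z
    simp [dotProduct, mulVec_sub]
  have hφ : ∀ s : ℝ, HasDerivAt (fun s : ℝ => a - s / 4) (-(1 / 4)) s := fun s =>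
    ((hasDerivAt_id s).div_const 4).const_sub a
  rw [grad, e, pderiv_comp (hφ _) hS, pderiv_sum fun k => (hlin _ _ _).fun_mul (hlin _ _ _)]
  simp_rw [pderiv_mul (hlin _ _ _) (hlin _ _ _), pderiv_sub_const, pderiv_mulVec_apply]
  have e1 : ∑ k, G k i * (((P * G) *ᵥ z.ofLp) k - (P *ᵥ x) k) =
      (Gᵀ *ᵥ P *ᵥ (G *ᵥ z.ofLp - x)) i := by
    rw [mulVec_sub P, mulVec_mulVec z.ofLp P G]
    simp only [mulVec, dotProduct, transpose_apply, Pi.sub_apply]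
  have e2 : ∑ k, ((G *ᵥ z.ofLp) k - x k) * (P * G) k i =
      (Gᵀ *ᵥ P *ᵥ (G *ᵥ z.ofLp - x)) i := by
    have : Gᵀ *ᵥ P *ᵥ (G *ᵥ z.ofLp - x) = (P * G)ᵀ *ᵥ (G *ᵥ z.ofLp - x) := by
      rw [transpose_mul, hP', mulVec_mulVec]
    rw [this]
    simp [mulVec, dotProduct, mul_comm]
  rw [Finset.sum_add_distrib, e1, e2, Pi.smul_apply, smul_eq_mul]
  ring

lemma L_quadratic {P G : Matrix (Fin N) (Fin N) ℝ} (hP : P.IsHermitian) (a : ℝ)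
    (x : Fin N → ℝ) (A D : Matrix (Fin N) (Fin N) ℝ) (hA : A.IsHermitian) (z : 𝕍) :
    L A D (fun z : 𝕍 => a - (G *ᵥ z.ofLp - x) ⬝ᵥ P *ᵥ (G *ᵥ z.ofLp - x) / 4) z =
      -(P * (G * A * Gᵀ)).trace / 2 -
        (G *ᵥ D *ᵥ z.ofLp) ⬝ᵥ P *ᵥ (G *ᵥ z.ofLp - x) / 2 := by
  set ψ : 𝕍 → ℝ := fun z : 𝕍 => a - (G *ᵥ z.ofLp - x) ⬝ᵥ P *ᵥ (G *ᵥ z.ofLp - x) / 4 with hψ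
  have hg : ∀ i z, pderiv i ψ z = (-1 / 2) * (Gᵀ *ᵥ P *ᵥ (G *ᵥ z.ofLp - x)) i := fun i z =>
    congrFun (grad_quadratic hP a x z) i
  have hH : ∀ i j, pderiv j (pderiv i ψ) z = (-1 / 2) * (Gᵀ * P * G) i j := by
    intro i j
    have e : pderiv i ψ = fun z : 𝕍 => (fun s : ℝ => (-1 / 2) * s)
        (((Gᵀ * P * G) *ᵥ z.ofLp) i - ((Gᵀ * P) *ᵥ x) i) := by
      ext z
      rw [hg]
      simp [mulVec_sub, mulVec_mulVec, Matrix.mul_assoc]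
    have hφ : ∀ s : ℝ, HasDerivAt (fun s : ℝ => (-1 / 2) * s) (-1 / 2) s := fun s => by
      simpa using (hasDerivAt_id s).const_mul (-1 / 2 : ℝ)
    rw [e, pderiv_comp (hφ _)
      ((((contDiff_mulVec_apply _ i (n := 1)).differentiable one_ne_zero) z).sub_const _),
      pderiv_sub_const, pderiv_mulVec_apply]
  rw [L_eq]
  simp_rw [hH, hg]
  have e1 : (∑ i, ∑ j, A i j * (-1 / 2 * (Gᵀ * P * G) i j)) = -(P * (G * A * Gᵀ)).trace / 2 := by
    have hA' : Aᵀ = A := by simpa [IsHermitian, conjTranspose_eq_transpose_of_trivial] using hA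
    have : (P * (G * A * Gᵀ)).trace = ∑ i, ∑ j, A i j * (Gᵀ * P * G) i j := by
      rw [trace_mul_comm, Matrix.mul_assoc (G * A), Matrix.mul_assoc G A, trace_mul_comm,
        Matrix.mul_assoc, Finset.sum_comm]
      simp only [trace, Matrix.diag_apply, Matrix.mul_apply (M := A)]
      exact Finset.sum_congr rfl fun i _ => Finset.sum_congr rfl fun j _ => by
        rw [← congrFun (congrFun hA' i) j, transpose_apply]
    have e : ∀ i j, A i j * (-1 / 2 * (Gᵀ * P * G) i j) =
        (-1 / 2) * (A i j * (Gᵀ * P * G) i j) := fun i j => by ring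
    simp_rw [this, e, ← Finset.mul_sum]
    ring
  have e2 : ∑ i, (D *ᵥ z.ofLp) i * (-1 / 2 * (Gᵀ *ᵥ P *ᵥ (G *ᵥ z.ofLp - x)) i) =
      -((G *ᵥ D *ᵥ z.ofLp) ⬝ᵥ P *ᵥ (G *ᵥ z.ofLp - x) / 2) := by
    have : (G *ᵥ D *ᵥ z.ofLp) ⬝ᵥ P *ᵥ (G *ᵥ z.ofLp - x) =
        ∑ i, (D *ᵥ z.ofLp) i * (Gᵀ *ᵥ P *ᵥ (G *ᵥ z.ofLp - x)) i := by
      rw [dotProduct_comm, dotProduct_mulVec, ← mulVec_transpose, dotProduct_comm]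
      rfl
    rw [this, Finset.sum_div, ← Finset.sum_neg_distrib]
    exact Finset.sum_congr rfl fun i _ => by ring
  rw [e1, e2]
  ring

lemma hasDerivAt_entry {M : ℝ → Matrix (Fin N) (Fin N) ℝ} {M' : Matrix (Fin N) (Fin N) ℝ} {t : ℝ}
    (hM : HasDerivAt M M' t) (i j : Fin N) : HasDerivAt (fun s => M s i j) (M' i j) t :=
  (entryLinearMap ℝ ℝ i j).toContinuousLinearMap.hasFDerivAt.comp_hasDerivAt t hM

lemma hasDerivAt_mulVec {M : ℝ → Matrix (Fin N) (Fin N) ℝ} {M' : Matrix (Fin N) (Fin N) ℝ}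
    {v : ℝ → Fin N → ℝ} {v' : Fin N → ℝ} {t : ℝ} (hM : HasDerivAt M M' t) (hv : HasDerivAt v v' t) :
    HasDerivAt (fun s => M s *ᵥ v s) (M' *ᵥ v t + M t *ᵥ v') t := by
  refine hasDerivAt_pi.2 fun i => ?_
  change HasDerivAt (fun s => ∑ j, M s i j * v s j) _ t
  refine (HasDerivAt.fun_sum fun j _ =>
    (hasDerivAt_entry hM i j).fun_mul (hasDerivAt_pi.1 hv j)).congr_deriv ?_
  simp [mulVec, dotProduct, Finset.sum_add_distrib]

lemma hasDerivAt_dotProduct {v w : ℝ → Fin N → ℝ} {v' w' : Fin N → ℝ} {t : ℝ}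
    (hv : HasDerivAt v v' t) (hw : HasDerivAt w w' t) :
    HasDerivAt (fun s => v s ⬝ᵥ w s) (v' ⬝ᵥ w t + v t ⬝ᵥ w') t := by
  change HasDerivAt (fun s => ∑ j, v s j * w s j) _ t
  refine (HasDerivAt.fun_sum fun j _ =>
    (hasDerivAt_pi.1 hv j).fun_mul (hasDerivAt_pi.1 hw j)).congr_deriv ?_
  simp [dotProduct, Finset.sum_add_distrib]

lemma hasDerivAt_inv {M : ℝ → Matrix (Fin N) (Fin N) ℝ} {M' : Matrix (Fin N) (Fin N) ℝ} {t : ℝ}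
    (hM : HasDerivAt M M' t) (h : (M t).det ≠ 0) :
    HasDerivAt (fun s => (M s)⁻¹) (-((M t)⁻¹ * M' * (M t)⁻¹)) t := by
  have hu : IsUnit (M t) := (isUnit_iff_isUnit_det _).2 h.isUnit
  obtain ⟨U, hU⟩ := hu
  have h1 := hasFDerivAt_ringInverse (𝕜 := ℝ) U
  rw [hU] at h1
  have h2 := h1.comp_hasDerivAt t hM
  have e : (fun s => (M s)⁻¹) = Ring.inverse ∘ M := by
    ext1 s; exact nonsing_inv_eq_ringInverse _
  rw [e]
  refine h2.congr_deriv ?_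
  have : (↑U⁻¹ : Matrix (Fin N) (Fin N) ℝ) = (M t)⁻¹ := by
    rw [← hU, coe_units_inv]
  simp [this, Matrix.mul_assoc]

/-- Half the covariance matrix of `E(r)Xᵣ`, where `X` is the process generated by `L A B` and `X₀` is
a centred Gaussian with covariance `2ε`. -/
noncomputable def cov (A B : Matrix (Fin N) (Fin N) ℝ) (ε r : ℝ) : Matrix (Fin N) (Fin N) ℝ :=
  ε • (1 : Matrix (Fin N) (Fin N) ℝ) + C A B r

/-- The displacement `E(r)z - x` entering the kernel with pole `x` at time lag `r`. -/
noncomputable def disp (B : Matrix (Fin N) (Fin N) ℝ) (x : Fin N → ℝ) (r : ℝ) (z : 𝕍) : Fin N → ℝ :=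
  E B r *ᵥ z.ofLp - x

/-- The logarithm of the Gaussian kernel with pole `x` and time lag `r`, mollified by `ε`, without
the factor `(4π)^{-N/2}`. -/
noncomputable def logKernel (A B : Matrix (Fin N) (Fin N) ℝ) (ε : ℝ) (x : Fin N → ℝ) (r : ℝ)
    (z : 𝕍) : ℝ :=
  -Real.log (cov A B ε r).det / 2 - disp B x r z ⬝ᵥ (cov A B ε r)⁻¹ *ᵥ disp B x r z / 4

lemma isHermitian_cov (hA : A.IsHermitian) (ε r : ℝ) : (cov A B ε r).IsHermitian := by
  rw [IsHermitian, cov, conjTranspose_eq_transpose_of_trivial, transpose_add, transpose_C hA,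
    transpose_smul, transpose_one]

lemma contDiff_logKernel (A B : Matrix (Fin N) (Fin N) ℝ) (ε : ℝ) (x : Fin N → ℝ) (r : ℝ) :
    ContDiff ℝ 2 (logKernel A B ε x r) := contDiff_quadratic _ _ _ _

lemma grad_logKernel (hA : A.IsHermitian) (ε : ℝ) (x : Fin N → ℝ) (r : ℝ) (z : 𝕍) :
    grad (logKernel A B ε x r) z =
      (-1 / 2 : ℝ) • ((E B r)ᵀ *ᵥ (cov A B ε r)⁻¹ *ᵥ disp B x r z) :=
  grad_quadratic (isHermitian_cov hA ε r).inv _ _ _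

/-- The logarithmic form of the forward Kolmogorov equation satisfied by the kernel. -/
lemma hasDerivAt_logKernel (hA : A.IsHermitian) {ε r : ℝ} (hr : (cov A B ε r).det ≠ 0)
    (x : Fin N → ℝ) (z : 𝕍) :
    HasDerivAt (fun r => logKernel A B ε x r z)
      (L A (-B) (logKernel A B ε x r) z +
        grad (logKernel A B ε x r) z ⬝ᵥ A *ᵥ grad (logKernel A B ε x r) z) r := by
  have hM : HasDerivAt (cov A B ε) (E B r * A * (E B r)ᵀ) r := (hasDerivAt_C A B r).const_add _
  have hv : HasDerivAt (fun r => disp B x r z) (-(E B r *ᵥ B *ᵥ z.ofLp)) r := by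
    refine ((hasDerivAt_mulVec (hasDerivAt_E B r) (hasDerivAt_const r z.ofLp)).sub_const
      x).congr_deriv ?_
    simp [neg_mulVec]
  have hq := hasDerivAt_dotProduct hv (hasDerivAt_mulVec (hasDerivAt_inv hM hr) hv)
  have hd := ((hasDerivAt_det hM hr).log hr).neg.div_const 2
  refine (hd.sub (hq.div_const 4)).congr_deriv ?_
  have hPh := (isHermitian_cov (B := B) hA ε r).inv
  have hL := L_quadratic (G := E B r) hPh (-Real.log (cov A B ε r).det / 2) x A (-B) hA z
  rw [show L A (-B) (logKernel A B ε x r) z = _ from hL, grad_logKernel hA]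
  change _ = -((cov A B ε r)⁻¹ * (E B r * A * (E B r)ᵀ)).trace / 2 -
    (E B r *ᵥ (-B) *ᵥ z.ofLp) ⬝ᵥ (cov A B ε r)⁻¹ *ᵥ disp B x r z / 2 + _
  set P := (cov A B ε r)⁻¹
  set v := disp B x r z
  have e1 : v ⬝ᵥ P *ᵥ (-(E B r *ᵥ B *ᵥ z.ofLp)) = -((E B r *ᵥ B *ᵥ z.ofLp) ⬝ᵥ P *ᵥ v) := by
    rw [dotProduct_mulVec_comm_of_isHermitian hPh, neg_dotProduct]
  have e2 : v ⬝ᵥ (-(P * (E B r * A * (E B r)ᵀ) * P)) *ᵥ v =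
      -(((E B r)ᵀ *ᵥ P *ᵥ v) ⬝ᵥ A *ᵥ ((E B r)ᵀ *ᵥ P *ᵥ v)) := by
    have hP' : Pᵀ = P := by simpa [IsHermitian, conjTranspose_eq_transpose_of_trivial] using hPh
    rw [neg_mulVec, dotProduct_neg, Matrix.mul_assoc, ← mulVec_mulVec, ← mulVec_mulVec,
      ← mulVec_mulVec, ← mulVec_mulVec, dotProduct_mulVec v P, ← mulVec_transpose, hP',
      dotProduct_mulVec _ (E B r), ← mulVec_transpose]
  rw [dotProduct_add, e1, e2, neg_mulVec, mulVec_neg, neg_dotProduct,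
    mul_div_cancel_left₀ _ hr, mulVec_smul, dotProduct_smul, smul_dotProduct]
  simp only [smul_eq_mul]
  ring

end Kernel

/-! ### Pairing a solution with the truncated kernel -/

section Pairing

open MeasureTheory Set
open scoped Matrix.Norms.Operator

variable {N : ℕ} {A B : Matrix (Fin N) (Fin N) ℝ}

local notation "𝕍" => EuclideanSpace ℝ (Fin N)

/-- Differentiation under the integral sign for integrands supported in a fixed compact set. -/
lemma hasDerivAt_integral_of_compact {f f' : ℝ → 𝕍 → ℝ} {a b : ℝ} {S : Set 𝕍} (hS : IsCompact S)
    (hf : ContinuousOn (Function.uncurry f) (Icc a b ×ˢ univ))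
    (hf' : ContinuousOn (Function.uncurry f') (Icc a b ×ˢ univ))
    (hd : ∀ r ∈ Ioo a b, ∀ z, HasDerivAt (fun r => f r z) (f' r z) r)
    (h0 : ∀ r ∈ Icc a b, ∀ z ∉ S, f r z = 0) (h0' : ∀ r ∈ Icc a b, ∀ z ∉ S, f' r z = 0)
    {r : ℝ} (hr : r ∈ Ioo a b) :
    HasDerivAt (fun r => ∫ z, f r z) (∫ z, f' r z) r := by
  have hslice : ∀ {g : ℝ → 𝕍 → ℝ}, ContinuousOn (Function.uncurry g) (Icc a b ×ˢ univ) →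
      ∀ s ∈ Icc a b, Continuous (g s) := fun {g} hg s hs => by
    rw [← continuousOn_univ]
    exact hg.comp (Continuous.prodMk_right s).continuousOn fun z _ => ⟨hs, mem_univ z⟩
  have hsupp : ∀ {g : 𝕍 → ℝ}, (∀ z ∉ S, g z = 0) → HasCompactSupport g := fun hg =>
    HasCompactSupport.intro hS hg
  obtain ⟨K, hK⟩ := ((isCompact_Icc (a := a) (b := b)).prod hS).exists_bound_of_continuousOn
    (hf'.mono (prod_mono le_rfl (subset_univ S)))
  have hrI := Ioo_subset_Icc_self hr
  refine (hasDerivAt_integral_of_dominated_loc_of_deriv_le (s := Ioo a b)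
    (bound := S.indicator fun _ => K) (Ioo_mem_nhds hr.1 hr.2) ?_ ?_ ?_ ?_ ?_ ?_).2
  · filter_upwards [Ioo_mem_nhds hr.1 hr.2] with s hs
    exact (hslice hf s (Ioo_subset_Icc_self hs)).aestronglyMeasurable
  · exact (hslice hf r hrI).integrable_of_hasCompactSupport (hsupp (h0 r hrI))
  · exact (hslice hf' r hrI).aestronglyMeasurable
  · refine Eventually.of_forall fun z s hs => ?_
    by_cases hz : z ∈ S
    · rw [indicator_of_mem hz]
      exact hK (s, z) ⟨Ioo_subset_Icc_self hs, hz⟩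
    · rw [indicator_of_notMem hz, h0' s (Ioo_subset_Icc_self hs) z hz, norm_zero]
  · exact (integrable_indicator_iff hS.measurableSet).2 (integrableOn_const hS.measure_ne_top)
  · exact Eventually.of_forall fun z s hs => hd s hs z

lemma continuous_L {v : 𝕍 → ℝ} (hv : ContDiff ℝ 2 v) : Continuous (L A B v) := by
  have h1 : ∀ i, ContDiff ℝ 1 (pderiv i v) := contDiff_pderiv hv (by norm_num)
  have h2 : ∀ i j, Continuous (pderiv j (pderiv i v)) := fun i j =>
    (contDiff_pderiv (m := 0) (h1 i) (by norm_num) j).continuous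
  rw [funext (L_eq A B v)]
  refine (continuous_finsetSum _ fun i _ => continuous_finsetSum _ fun j _ =>
    continuous_const.mul (h2 i j)).add (continuous_finsetSum _ fun i _ => ?_)
  exact (contDiff_mulVec_apply B i (n := 0)).continuous.mul (h1 i).continuous

lemma cov_form (A B : Matrix (Fin N) (Fin N) ℝ) (ε r : ℝ) (w : Fin N → ℝ) :
    w ⬝ᵥ cov A B ε r *ᵥ w = ε * (w ⬝ᵥ w) + w ⬝ᵥ C A B r *ᵥ w := by
  rw [cov, add_mulVec, dotProduct_add, smul_mulVec, one_mulVec, dotProduct_smul, smul_eq_mul]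

lemma posDef_smul_one {ε : ℝ} (hε : 0 < ε) : (ε • (1 : Matrix (Fin N) (Fin N) ℝ)).PosDef :=
  PosDef.one.smul hε

lemma posDef_cov (hC : ∀ t : ℝ, 0 < t → (C A B t).PosDef) {ε r : ℝ} (hε : 0 < ε) (hr : 0 ≤ r) :
    (cov A B ε r).PosDef :=
  (posDef_smul_one hε).add_posSemidef (posSemidef_C hC hr)

lemma log_det_cov_ge (hC : ∀ t : ℝ, 0 < t → (C A B t).PosDef) {ε r : ℝ} (hε : 0 < ε)
    (hr : 0 ≤ r) : N * Real.log ε ≤ Real.log (cov A B ε r).det := by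
  have h := det_le_det_add (posDef_smul_one (N := N) hε) (posSemidef_C hC hr)
  rw [det_smul, det_one, mul_one, Fintype.card_fin] at h
  rw [← Real.log_pow]
  exact Real.log_le_log (by positivity) h

lemma continuousAt_inv {M : Matrix (Fin N) (Fin N) ℝ} (hM : M.det ≠ 0) :
    ContinuousAt (fun X : Matrix (Fin N) (Fin N) ℝ => X⁻¹) M := by
  obtain ⟨U, hU⟩ := (isUnit_iff_isUnit_det M).2 hM.isUnit
  have e : (fun X : Matrix (Fin N) (Fin N) ℝ => X⁻¹) = Ring.inverse := by
    ext1 X; exact nonsing_inv_eq_ringInverse _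
  rw [e, ← hU]
  exact NormedRing.inverse_continuousAt U

lemma continuous_cov (A B : Matrix (Fin N) (Fin N) ℝ) :
    Continuous fun p : ℝ × ℝ => cov A B p.1 p.2 :=
  (continuous_fst.smul continuous_const).add ((continuous_C A B).comp continuous_snd)

lemma continuous_disp (B : Matrix (Fin N) (Fin N) ℝ) (x : Fin N → ℝ) :
    Continuous fun p : ℝ × 𝕍 => disp B x p.1 p.2 :=
  (((continuous_E B).comp continuous_fst).matrix_mulVec (by fun_prop)).sub continuous_const

/-- Joint continuity of the logarithmic kernel in `(ε, r, z)`. -/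
lemma continuousAt_logKernel (x : Fin N → ℝ) {ε r : ℝ} (h : (cov A B ε r).det ≠ 0) (z : 𝕍) :
    ContinuousAt (fun p : ℝ × ℝ × 𝕍 => logKernel A B p.1 x p.2.1 p.2.2) (ε, r, z) := by
  have hcov : ContinuousAt (fun p : ℝ × ℝ × 𝕍 => cov A B p.1 p.2.1) (ε, r, z) :=
    ((continuous_cov A B).comp (continuous_fst.prodMk continuous_snd.fst)).continuousAt
  have hinv : ContinuousAt (fun p : ℝ × ℝ × 𝕍 => (cov A B p.1 p.2.1)⁻¹) (ε, r, z) :=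
    ContinuousAt.comp (f := fun p : ℝ × ℝ × 𝕍 => cov A B p.1 p.2.1) (continuousAt_inv h) hcov
  have hdet : ContinuousAt (fun p : ℝ × ℝ × 𝕍 => Real.log (cov A B p.1 p.2.1).det) (ε, r, z) :=
    ContinuousAt.log (contDiff_det.continuous.continuousAt.comp hcov) h
  have hdisp : ContinuousAt (fun p : ℝ × ℝ × 𝕍 => disp B x p.2.1 p.2.2) (ε, r, z) :=
    ((continuous_disp B x).comp continuous_snd).continuousAt
  have hg : Continuous fun q : ℝ × Matrix (Fin N) (Fin N) ℝ × (Fin N → ℝ) =>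
      -q.1 / 2 - q.2.2 ⬝ᵥ q.2.1 *ᵥ q.2.2 / 4 := by fun_prop
  exact ContinuousAt.comp (f := fun p : ℝ × ℝ × 𝕍 => (Real.log (cov A B p.1 p.2.1).det,
    (cov A B p.1 p.2.1)⁻¹, disp B x p.2.1 p.2.2)) hg.continuousAt (hdet.prodMk (hinv.prodMk hdisp))

/-- The time derivative of the logarithmic kernel. -/
noncomputable def logKernelDeriv (A B : Matrix (Fin N) (Fin N) ℝ) (ε : ℝ) (x : Fin N → ℝ) (r : ℝ)
    (z : 𝕍) : ℝ :=
  L A (-B) (logKernel A B ε x r) z +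
    grad (logKernel A B ε x r) z ⬝ᵥ A *ᵥ grad (logKernel A B ε x r) z

lemma continuousAt_logKernelDeriv (hA : A.IsHermitian) (x : Fin N → ℝ) {ε r : ℝ}
    (h : (cov A B ε r).det ≠ 0) (z : 𝕍) :
    ContinuousAt (fun p : ℝ × 𝕍 => logKernelDeriv A B ε x p.1 p.2) (r, z) := by
  have e : (fun p : ℝ × 𝕍 => logKernelDeriv A B ε x p.1 p.2) = fun p : ℝ × 𝕍 =>
      -((cov A B ε p.1)⁻¹ * (E B p.1 * A * (E B p.1)ᵀ)).trace / 2 -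
        (E B p.1 *ᵥ (-B) *ᵥ p.2.ofLp) ⬝ᵥ (cov A B ε p.1)⁻¹ *ᵥ disp B x p.1 p.2 / 2 +
      ((-1 / 2 : ℝ) • ((E B p.1)ᵀ *ᵥ (cov A B ε p.1)⁻¹ *ᵥ disp B x p.1 p.2)) ⬝ᵥ
        A *ᵥ ((-1 / 2 : ℝ) • ((E B p.1)ᵀ *ᵥ (cov A B ε p.1)⁻¹ *ᵥ disp B x p.1 p.2)) := by
    ext p
    rw [logKernelDeriv, grad_logKernel hA]
    congr 1
    exact L_quadratic (isHermitian_cov hA ε p.1).inv _ x A (-B) hA p.2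
  rw [e]
  have hinv : ContinuousAt (fun p : ℝ × 𝕍 => (cov A B ε p.1)⁻¹) (r, z) :=
    ContinuousAt.comp (f := fun p : ℝ × 𝕍 => cov A B ε p.1) (continuousAt_inv h)
      ((continuous_cov A B).comp (continuous_const.prodMk continuous_fst)).continuousAt
  have hg : Continuous fun q : Matrix (Fin N) (Fin N) ℝ × Matrix (Fin N) (Fin N) ℝ ×
      (Fin N → ℝ) × (Fin N → ℝ) =>
      -(q.1 * (q.2.1 * A * q.2.1ᵀ)).trace / 2 -
        (q.2.1 *ᵥ (-B) *ᵥ q.2.2.1) ⬝ᵥ q.1 *ᵥ q.2.2.2 / 2 +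
      ((-1 / 2 : ℝ) • (q.2.1ᵀ *ᵥ q.1 *ᵥ q.2.2.2)) ⬝ᵥ
        A *ᵥ ((-1 / 2 : ℝ) • (q.2.1ᵀ *ᵥ q.1 *ᵥ q.2.2.2)) := by fun_prop
  have hofLp : Continuous fun p : ℝ × 𝕍 => p.2.ofLp := by fun_prop
  exact ContinuousAt.comp (f := fun p : ℝ × 𝕍 =>
    ((cov A B ε p.1)⁻¹, E B p.1, p.2.ofLp, disp B x p.1 p.2)) hg.continuousAt
    (hinv.prodMk (((continuous_E B).comp continuous_fst).continuousAt.prodMk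
      (hofLp.continuousAt.prodMk (continuous_disp B x).continuousAt)))

/-- On a bounded time interval the superlevel sets of the kernel stay in a compact set. -/
lemma exists_compact_logKernel_le (hC : ∀ t : ℝ, 0 < t → (C A B t).PosDef) {ε : ℝ} (hε : 0 < ε)
    (x : Fin N → ℝ) (T k : ℝ) :
    ∃ S : Set 𝕍, IsCompact S ∧ ∀ r ∈ Icc 0 T, ∀ z ∉ S, logKernel A B ε x r z ≤ -k := by
  have htr : Continuous fun r => (cov A B ε r).trace :=
    ((continuous_cov A B).comp (continuous_const.prodMk continuous_id)).matrix_trace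
  obtain ⟨τ, hτ⟩ := (isCompact_Icc (a := (0 : ℝ)) (b := T)).exists_bound_of_continuousOn
    htr.continuousOn
  set R := 4 * (k - N * Real.log ε / 2) with hR
  refine ⟨(fun p : ℝ × (Fin N → ℝ) => WithLp.toLp 2 (E B (-p.1) *ᵥ (p.2 + x))) ''
    (Icc 0 T ×ˢ Metric.closedBall 0 (√(τ * R))), ?_, fun r hr z hz => ?_⟩
  · refine (isCompact_Icc.prod (isCompact_closedBall _ _)).image ?_
    have : Continuous fun p : ℝ × (Fin N → ℝ) => E B (-p.1) *ᵥ (p.2 + x) :=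
      ((continuous_E B).comp continuous_fst.neg).matrix_mulVec (by fun_prop)
    exact (PiLp.continuous_toLp 2 _).comp this
  · by_contra! hlt
    refine hz ⟨(r, disp B x r z), ⟨hr, ?_⟩, ?_⟩
    · have hM := posDef_cov hC hε hr.1
      have h1 := dotProduct_self_le_trace_mul_inv_form hM (disp B x r z)
      have h2 := log_det_cov_ge (B := B) hC hε hr.1
      have h3 : disp B x r z ⬝ᵥ (cov A B ε r)⁻¹ *ᵥ disp B x r z ≤ R := by
        rw [logKernel] at hlt
        rw [hR]
        linarith
      have h4 := (le_abs_self _).trans (hτ r hr)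
      have h5 := form_nonneg hM.inv.posSemidef (disp B x r z)
      have h6 : 0 ≤ (cov A B ε r).trace := hM.posSemidef.trace_nonneg
      have h7 : disp B x r z ⬝ᵥ disp B x r z ≤ τ * R :=
        h1.trans (mul_le_mul h4 h3 h5 (h6.trans h4))
      rw [mem_closedBall_zero_iff, pi_norm_le_iff_of_nonneg (Real.sqrt_nonneg _)]
      intro i
      refine Real.abs_le_sqrt (le_trans ?_ h7)
      rw [dotProduct, sq]
      exact Finset.single_le_sum (f := fun i => disp B x r z i * disp B x r z i)
        (fun i _ => mul_self_nonneg _) (Finset.mem_univ i)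
    · simp only [disp, sub_add_cancel, mulVec_mulVec, E_neg_mul, one_mulVec]

/-- The pairing of `u` at time `t - r` with the truncated kernel with pole `(x, t)`. -/
noncomputable def pairing (A B : Matrix (Fin N) (Fin N) ℝ) (u : 𝕍 × ℝ → ℝ) (k ε : ℝ)
    (x : Fin N → ℝ) (t r : ℝ) : ℝ :=
  ∫ z, u (z, t - r) * trunc k (logKernel A B ε x r z)

/-- The rate at which `pairing` decreases. -/
noncomputable def dissipation (A B : Matrix (Fin N) (Fin N) ℝ) (u : 𝕍 × ℝ → ℝ) (k ε : ℝ)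
    (x : Fin N → ℝ) (t r : ℝ) (z : 𝕍) : ℝ :=
  u (z, t - r) * ((trunc₂ k (logKernel A B ε x r z) - trunc₁ k (logKernel A B ε x r z)) *
    (grad (logKernel A B ε x r) z ⬝ᵥ A *ᵥ grad (logKernel A B ε x r) z))

variable {u : EuclideanSpace ℝ (Fin N) × ℝ → ℝ}

lemma continuousOn_logKernel (hC : ∀ t : ℝ, 0 < t → (C A B t).PosDef) {ε : ℝ} (hε : 0 < ε)
    (x : Fin N → ℝ) (T : ℝ) :
    ContinuousOn (fun p : ℝ × 𝕍 => logKernel A B ε x p.1 p.2) (Icc 0 T ×ˢ univ) := by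
  rintro ⟨r, z⟩ ⟨hr, -⟩
  have h := continuousAt_logKernel x (posDef_cov hC hε hr.1).det_pos.ne' z
  exact (ContinuousAt.comp (f := fun p : ℝ × 𝕍 => (ε, p.1, p.2)) (x := (r, z)) h
    (by fun_prop)).continuousWithinAt

lemma continuousOn_pairing_integrand (hC : ∀ t : ℝ, 0 < t → (C A B t).PosDef)
    (hu : ContDiff ℝ ∞ u) {ε : ℝ} (hε : 0 < ε) (k : ℝ) (x : Fin N → ℝ) (t T : ℝ) :
    ContinuousOn (Function.uncurry fun r z => u (z, t - r) * trunc k (logKernel A B ε x r z))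
      (Icc 0 T ×ˢ univ) := by
  have h1 : Continuous fun p : ℝ × 𝕍 => u (p.2, t - p.1) := hu.continuous.comp (by fun_prop)
  exact h1.continuousOn.mul
    ((contDiff_trunc k).continuous.comp_continuousOn (continuousOn_logKernel hC hε x T))

lemma continuousOn_pairing (hC : ∀ t : ℝ, 0 < t → (C A B t).PosDef) (hu : ContDiff ℝ ∞ u)
    {ε : ℝ} (hε : 0 < ε) (k : ℝ) (x : Fin N → ℝ) (t T : ℝ) :
    ContinuousOn (pairing A B u k ε x t) (Icc 0 T) := by
  obtain ⟨S, hS, hS0⟩ := exists_compact_logKernel_le hC hε x T k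
  refine continuousOn_integral_of_compact_support hS
    (continuousOn_pairing_integrand hC hu hε k x t T) fun r z hr hz => ?_
  rw [trunc_eq_zero (hS0 r hr z hz), mul_zero]

lemma fderiv_time_eq (hu : ContDiff ℝ ∞ u) (hK : ∀ z, K A B u z = 0) (z : 𝕍) (τ : ℝ) :
    fderiv ℝ u (z, τ) (0, 1) = L A B (fun y => u (y, τ)) z := by
  have h1 : HasDerivAt (fun s => u (z, s)) (fderiv ℝ u (z, τ) (0, 1)) τ := by
    have hd := ((hu.differentiable (by simp)) (z, τ)).hasFDerivAt
    exact HasFDerivAt.comp_hasDerivAt τ hd ((hasDerivAt_const τ z).prodMk (hasDerivAt_id τ))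
  have h2 := hK (z, τ)
  rw [K] at h2
  rw [← h1.deriv]
  linarith

lemma hasDerivAt_pairing (hA : A.IsHermitian) (hC : ∀ t : ℝ, 0 < t → (C A B t).PosDef)
    (hB : B.trace = 0) (hu : ContDiff ℝ ∞ u) (hK : ∀ z, K A B u z = 0)
    {ε : ℝ} (hε : 0 < ε) (k : ℝ) (x : Fin N → ℝ) (t : ℝ) {r : ℝ} (hr : 0 < r) :
    HasDerivAt (pairing A B u k ε x t) (-∫ z, dissipation A B u k ε x t r z) r := by
  obtain ⟨S, hS, hS0⟩ := exists_compact_logKernel_le hC hε x (r + 1) k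
  have hrI : r ∈ Ioo 0 (r + 1) := ⟨hr, by linarith⟩
  have hrI' := Ioo_subset_Icc_self hrI
  set f' : ℝ → 𝕍 → ℝ := fun r z =>
    -fderiv ℝ u (z, t - r) (0, 1) * trunc k (logKernel A B ε x r z) +
      u (z, t - r) * (trunc₁ k (logKernel A B ε x r z) * logKernelDeriv A B ε x r z) with hf'
  have hcψ := continuousOn_logKernel hC hε x (r + 1)
  have hcu : Continuous fun p : ℝ × 𝕍 => u (p.2, t - p.1) := hu.continuous.comp (by fun_prop)
  have hcu' : Continuous fun p : ℝ × 𝕍 => fderiv ℝ u (p.2, t - p.1) (0, 1) :=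
    ((hu.continuous_fderiv (by simp)).comp (by fun_prop)).clm_apply continuous_const
  have hcd : ContinuousOn (fun p : ℝ × 𝕍 => logKernelDeriv A B ε x p.1 p.2)
      (Icc 0 (r + 1) ×ˢ univ) := by
    rintro ⟨s, z⟩ ⟨hs, -⟩
    exact (continuousAt_logKernelDeriv hA x
      (posDef_cov hC hε hs.1).det_pos.ne' z).continuousWithinAt
  have hder := hasDerivAt_integral_of_compact (f' := f') hS
    (continuousOn_pairing_integrand hC hu hε k x t (r + 1))
    ((hcu'.neg.continuousOn.mul ((contDiff_trunc k).continuous.comp_continuousOn hcψ)).add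
      (hcu.continuousOn.mul (((continuous_trunc₁ k).comp_continuousOn hcψ).mul hcd)))
    (fun s hs z => by
      have h1 : HasDerivAt (fun s => u (z, t - s)) (-fderiv ℝ u (z, t - s) (0, 1)) s := by
        have hd := ((hu.differentiable (by simp)) (z, t - s)).hasFDerivAt
        refine (HasFDerivAt.comp_hasDerivAt s hd ((hasDerivAt_const s z).prodMk
          ((hasDerivAt_id s).const_sub t))).congr_deriv ?_
        rw [← map_neg]; simp
      have h2 := (hasDerivAt_trunc k _).comp s
        (hasDerivAt_logKernel hA (posDef_cov hC hε hs.1.le).det_pos.ne' x z)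
      exact h1.fun_mul h2)
    (fun s hs z hz => by rw [trunc_eq_zero (hS0 s hs z hz), mul_zero])
    (fun s hs z hz => by
      simp only [hf', trunc_eq_zero (hS0 s hs z hz), trunc₁_eq_zero (hS0 s hs z hz)]
      ring) hrI
  refine hder.congr_deriv ?_
  set ψ := logKernel A B ε x r with hψ
  have hψ2 : ContDiff ℝ 2 ψ := contDiff_logKernel A B ε x r
  set F : 𝕍 → ℝ := fun z => trunc k (ψ z) with hF
  set w : 𝕍 → ℝ := fun z => u (z, t - r) with hw
  have hw2 : ContDiff ℝ 2 w := (contDiff_infty.1 hu 2).comp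
    (contDiff_id.prodMk contDiff_const)
  have hF2 : ContDiff ℝ 2 F := (contDiff_trunc k).comp hψ2
  have hFc : HasCompactSupport F := HasCompactSupport.intro hS fun z hz =>
    trunc_eq_zero (hS0 r hrI' z hz)
  have hLF : ∀ z, L A (-B) F z = trunc₁ k (ψ z) * L A (-B) ψ z +
      trunc₂ k (ψ z) * (grad ψ z ⬝ᵥ A *ᵥ grad ψ z) := fun z =>
    L_comp A (-B) (hasDerivAt_trunc k) (hasDerivAt_trunc₁ k) hψ2 z
  have hdec : ∀ z, f' r z = -(L A B w z * F z) + w z * L A (-B) F z -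
      dissipation A B u k ε x t r z := by
    intro z
    rw [hLF]
    simp only [hf', fderiv_time_eq hu hK, dissipation, logKernelDeriv, ← hψ, hF, hw]
    ring
  have hgrad : Continuous (grad ψ) := continuous_pi fun i =>
    (contDiff_pderiv (m := 1) hψ2 (by norm_num) i).continuous
  have i1 : Integrable fun z => L A B w z * F z :=
    ((continuous_L hw2).mul hF2.continuous).integrable_of_hasCompactSupport hFc.mul_left
  have hcLF : HasCompactSupport (L A (-B) F) := HasCompactSupport.intro hS fun z hz => by
    have h0 := hS0 r hrI' z hz
    rw [hLF, trunc₁_eq_zero h0, trunc₂, trunc₁_eq_zero h0, cut_eq_zero h0]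
    ring
  have i2 : Integrable fun z => w z * L A (-B) F z :=
    (hw2.continuous.mul (continuous_L hF2)).integrable_of_hasCompactSupport hcLF.mul_left
  have i3 : Integrable (dissipation A B u k ε x t r) := by
    refine Continuous.integrable_of_hasCompactSupport ?_ (HasCompactSupport.intro hS fun z hz => ?_)
    · exact hw2.continuous.mul ((((continuous_trunc₂ k).comp hψ2.continuous).sub
        ((continuous_trunc₁ k).comp hψ2.continuous)).mul
        (hgrad.dotProduct (continuous_const.matrix_mulVec hgrad)))
    · have h0 := hS0 r hrI' z hz
      rw [dissipation, trunc₂, add_sub_cancel_left, cut_eq_zero h0]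
      ring
  simp_rw [hdec]
  have i12 : Integrable fun z => -(L A B w z * F z) + w z * L A (-B) F z := i1.neg.add i2
  rw [integral_sub i12 i3, integral_add (f := fun z => -(L A B w z * F z)) i1.neg i2, integral_neg,
    integral_L_mul hA hB hw2 hF2 hFc]
  ring

lemma dissipation_nonneg (hA : A.PosSemidef) (hu0 : ∀ z, 0 ≤ u z) (k ε : ℝ) (x : Fin N → ℝ)
    (t r : ℝ) (z : 𝕍) : 0 ≤ dissipation A B u k ε x t r z :=
  mul_nonneg (hu0 _) (mul_nonneg (sub_nonneg.2 (trunc₁_le_trunc₂ _ _)) (form_nonneg hA _))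

/-- The pairing of a nonnegative solution with the truncated kernel decreases with the time lag,
because the truncation is convex. -/
lemma pairing_le_pairing_zero (hA : A.PosSemidef) (hC : ∀ t : ℝ, 0 < t → (C A B t).PosDef)
    (hB : B.trace = 0) (hu : ContDiff ℝ ∞ u) (hK : ∀ z, K A B u z = 0) (hu0 : ∀ z, 0 ≤ u z)
    {ε : ℝ} (hε : 0 < ε) (k : ℝ) (x : Fin N → ℝ) (t : ℝ) {T : ℝ} (hT : 0 ≤ T) :
    pairing A B u k ε x t T ≤ pairing A B u k ε x t 0 := by
  have h := fun r (hr : r ∈ interior (Icc 0 T)) =>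
    hasDerivAt_pairing hA.1 hC hB hu hK hε k x t (r := r) (by rw [interior_Icc] at hr; exact hr.1)
  refine antitoneOn_of_deriv_nonpos (convex_Icc 0 T) (continuousOn_pairing hC hu hε k x t T)
    (fun r hr => (h r hr).differentiableAt.differentiableWithinAt) (fun r hr => ?_)
    (left_mem_Icc.2 hT) (right_mem_Icc.2 hT) hT
  rw [(h r hr).deriv, neg_nonpos]
  exact integral_nonneg fun z => dissipation_nonneg hA hu0 k ε x t r z

end Pairing

/-! ### A nonnegative solution dominates its kernel average -/

section LowerBound

open MeasureTheory Set
open scoped Matrix.Norms.Operator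

variable {N : ℕ} {A B : Matrix (Fin N) (Fin N) ℝ}
  {u : EuclideanSpace ℝ (Fin N) × ℝ → ℝ}

local notation "𝕍" => EuclideanSpace ℝ (Fin N)

/-- The total mass of the unnormalised kernel. -/
noncomputable def kernelMass (N : ℕ) : ℝ := (4 * Real.pi) ^ (N / 2 : ℝ)

lemma kernelMass_pos (N : ℕ) : 0 < kernelMass N := by
  unfold kernelMass; positivity

lemma logKernel_zero (A B : Matrix (Fin N) (Fin N) ℝ) {ε : ℝ} (hε : 0 < ε) (x z : 𝕍) :
    logKernel A B ε x.ofLp 0 z = -(N * Real.log ε) / 2 - ‖z - x‖ ^ 2 / (4 * ε) := by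
  have h1 : cov A B ε 0 = ε • (1 : Matrix (Fin N) (Fin N) ℝ) := by rw [cov, C_zero, add_zero]
  have h2 : (ε • (1 : Matrix (Fin N) (Fin N) ℝ))⁻¹ = ε⁻¹ • 1 := by
    refine inv_eq_left_inv ?_
    rw [smul_mul_smul_comm, one_mul, inv_mul_cancel₀ hε.ne', one_smul]
  have h3 : disp B x.ofLp 0 z = (z - x).ofLp := by
    rw [disp, E_zero, one_mulVec]; rfl
  rw [logKernel, h1, h2, h3, det_smul, det_one, mul_one, Fintype.card_fin, Real.log_pow,
    smul_mulVec, one_mulVec, dotProduct_smul, EuclideanSpace.real_norm_sq_eq]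
  have : (z - x).ofLp ⬝ᵥ (z - x).ofLp = ∑ i, (z - x).ofLp i ^ 2 := by simp [dotProduct, sq]
  rw [this, smul_eq_mul]
  field_simp

lemma integral_exp_logKernel_zero (A B : Matrix (Fin N) (Fin N) ℝ) {ε : ℝ} (hε : 0 < ε) (x : 𝕍) :
    ∫ z, Real.exp (logKernel A B ε x.ofLp 0 z) = kernelMass N := by
  have e : ∀ z : 𝕍, Real.exp (logKernel A B ε x.ofLp 0 z) =
      Real.exp (-(N * Real.log ε) / 2) * Real.exp (-(1 / (4 * ε)) * ‖z - x‖ ^ 2) := fun z => by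
    rw [logKernel_zero A B hε, ← Real.exp_add]
    congr 1; ring
  simp_rw [e]
  rw [integral_const_mul, integral_sub_right_eq_self
    (fun z : 𝕍 => Real.exp (-(1 / (4 * ε)) * ‖z‖ ^ 2)) x,
    GaussianFourier.integral_rexp_neg_mul_sq_norm (by positivity), finrank_euclideanSpace_fin,
    kernelMass, show Real.pi / (1 / (4 * ε)) = ε * (4 * Real.pi) by field_simp,
    Real.mul_rpow hε.le (by positivity), ← mul_assoc, Real.rpow_def_of_pos hε, ← Real.exp_add]
  rw [show -(N * Real.log ε) / 2 + Real.log ε * (N / 2) = 0 by ring, Real.exp_zero, one_mul]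

lemma integrable_exp_logKernel_zero (A B : Matrix (Fin N) (Fin N) ℝ) {ε : ℝ} (hε : 0 < ε) (x : 𝕍) :
    Integrable fun z => Real.exp (logKernel A B ε x.ofLp 0 z) := by
  by_contra h
  have := integral_exp_logKernel_zero A B hε x
  rw [integral_undef h] at this
  exact (kernelMass_pos N).ne this

lemma continuous_slice (hu : ContDiff ℝ ∞ u) (t : ℝ) : Continuous fun z : 𝕍 => u (z, t) :=
  hu.continuous.comp (by fun_prop)

lemma continuous_pairing_integrand (hu : ContDiff ℝ ∞ u) (k ε : ℝ) (x : Fin N → ℝ) (t r : ℝ) :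
    Continuous fun z => u (z, t - r) * trunc k (logKernel A B ε x r z) :=
  (continuous_slice hu _).mul
    ((contDiff_trunc k).continuous.comp (contDiff_logKernel A B ε x r).continuous)

lemma integrable_pairing_integrand (hC : ∀ t : ℝ, 0 < t → (C A B t).PosDef)
    (hu : ContDiff ℝ ∞ u) {ε : ℝ} (hε : 0 < ε) (k : ℝ) (x : Fin N → ℝ) (t : ℝ) {r : ℝ}
    (hr : 0 ≤ r) : Integrable fun z => u (z, t - r) * trunc k (logKernel A B ε x r z) := by
  obtain ⟨S, hS, hS0⟩ := exists_compact_logKernel_le hC hε x r k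
  refine (continuous_pairing_integrand hu k ε x t r).integrable_of_hasCompactSupport
    (HasCompactSupport.intro hS fun z hz => ?_)
  rw [trunc_eq_zero (hS0 r ⟨hr, le_rfl⟩ z hz), mul_zero]

lemma lintegral_pairing (hC : ∀ t : ℝ, 0 < t → (C A B t).PosDef)
    (hu : ContDiff ℝ ∞ u) (hu0 : ∀ z, 0 ≤ u z) {ε : ℝ} (hε : 0 < ε) (k : ℝ) (x : Fin N → ℝ)
    (t : ℝ) {r : ℝ} (hr : 0 ≤ r) :
    ∫⁻ z, ENNReal.ofReal (u (z, t - r) * trunc k (logKernel A B ε x r z)) =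
      ENNReal.ofReal (pairing A B u k ε x t r) :=
  (ofReal_integral_eq_lintegral_ofReal (integrable_pairing_integrand hC hu hε k x t hr)
    (Eventually.of_forall fun _ => mul_nonneg (hu0 _) (trunc_nonneg _ _))).symm

/-- At time lag `0` the truncated kernel concentrates at its pole as `ε = e⁻ⁿ → 0`: its support
shrinks to the pole while its mass stays bounded. -/
lemma eventually_pairing_zero_le (hu : ContDiff ℝ ∞ u) (hu0 : ∀ z, 0 ≤ u z) (x : 𝕍) (t : ℝ)
    {δ : ℝ} (hδ : 0 < δ) :
    ∀ᶠ n : ℕ in atTop, pairing A B u n (Real.exp (-n)) x.ofLp t 0 ≤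
      (u (x, t) + δ) * kernelMass N := by
  obtain ⟨ρ, hρ, hball⟩ := Metric.continuousAt_iff.1 (continuous_slice hu t).continuousAt δ hδ
  have hlim : Tendsto (fun n : ℕ => 4 * (1 + N / 2 : ℝ) * (n * Real.exp (-n))) atTop (𝓝 0) := by
    have h := (Real.tendsto_pow_mul_exp_neg_atTop_nhds_zero 1).comp tendsto_natCast_atTop_atTop
    simpa using h.const_mul (4 * (1 + N / 2 : ℝ))
  filter_upwards [hlim.eventually_lt_const (show 0 < ρ ^ 2 by positivity)] with n hn
  have hε := Real.exp_pos (-(n : ℝ))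
  rw [pairing, ← integral_exp_logKernel_zero A B hε x, ← integral_const_mul]
  refine integral_mono_of_nonneg
    (Eventually.of_forall fun z => mul_nonneg (hu0 _) (trunc_nonneg _ _))
    ((integrable_exp_logKernel_zero A B hε x).const_mul _) (Eventually.of_forall fun z => ?_)
  have hux := hu0 (x, t)
  simp only [sub_zero]
  rcases le_or_gt (logKernel A B (Real.exp (-n)) x.ofLp 0 z) (-n) with h | h
  · rw [trunc_eq_zero h, mul_zero]
    positivity
  · have hz : dist z x < ρ := by
      rw [logKernel_zero A B hε, Real.log_exp] at h
      have h1 : ‖z - x‖ ^ 2 / (4 * Real.exp (-n)) < n * (1 + N / 2) := by linarith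
      rw [div_lt_iff₀ (by positivity)] at h1
      rw [dist_eq_norm]
      exact lt_of_pow_lt_pow_left₀ 2 hρ.le (by linarith)
    have h1 := hball hz
    rw [Real.dist_eq] at h1
    have h2 := (abs_lt.1 h1).2
    exact mul_le_mul (by linarith) (trunc_le_exp _ _) (trunc_nonneg _ _) (by linarith)

lemma cov_zero (A B : Matrix (Fin N) (Fin N) ℝ) (r : ℝ) : cov A B 0 r = C A B r := by
  rw [cov, zero_smul, zero_add]

lemma tendsto_logKernel {ι : Type*} {l : Filter ι} {e : ι → ℝ} (x : Fin N → ℝ) {ε r : ℝ}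
    (h : (cov A B ε r).det ≠ 0) (z : 𝕍) (he : Tendsto e l (𝓝 ε)) :
    Tendsto (fun i => logKernel A B (e i) x r z) l (𝓝 (logKernel A B ε x r z)) := by
  have hpath : Tendsto (fun i => (e i, r, z)) l (𝓝 (ε, r, z)) :=
    he.prodMk_nhds tendsto_const_nhds
  have hcomp := (continuousAt_logKernel x h z).tendsto.comp hpath
  simp only [Function.comp_def] at hcomp
  exact hcomp

/-- A nonnegative solution dominates the average of its past values against the kernel. -/
lemma lintegral_kernel_le (hA : A.PosSemidef) (hC : ∀ t : ℝ, 0 < t → (C A B t).PosDef)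
    (hB : B.trace = 0) (hu : ContDiff ℝ ∞ u) (hK : ∀ z, K A B u z = 0) (hu0 : ∀ z, 0 ≤ u z)
    (x : 𝕍) (t : ℝ) {T : ℝ} (hT : 0 < T) :
    ∫⁻ z, ENNReal.ofReal (u (z, t - T) * Real.exp (logKernel A B 0 x.ofLp T z)) ≤
      ENNReal.ofReal (u (x, t) * kernelMass N) := by
  have key : ∀ δ : ℝ, 0 < δ →
      ∫⁻ z, ENNReal.ofReal (u (z, t - T) * Real.exp (logKernel A B 0 x.ofLp T z)) ≤
        ENNReal.ofReal ((u (x, t) + δ) * kernelMass N) := by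
    intro δ hδ
    set f : ℕ → 𝕍 → ENNReal := fun n z => ENNReal.ofReal
      (u (z, t - T) * trunc n (logKernel A B (Real.exp (-n)) x.ofLp T z)) with hf
    have hε : Tendsto (fun n : ℕ => Real.exp (-(n : ℝ))) atTop (𝓝 0) :=
      Real.tendsto_exp_neg_atTop_nhds_zero.comp tendsto_natCast_atTop_atTop
    have hlim : ∀ z, Tendsto (fun n => f n z) atTop
        (𝓝 (ENNReal.ofReal (u (z, t - T) * Real.exp (logKernel A B 0 x.ofLp T z)))) := by
      intro z
      refine ENNReal.tendsto_ofReal ((tendsto_trunc tendsto_natCast_atTop_atTop ?_).const_mul _)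
      exact tendsto_logKernel x.ofLp (by rw [cov_zero]; exact (hC T hT).det_pos.ne') z hε
    calc ∫⁻ z, ENNReal.ofReal (u (z, t - T) * Real.exp (logKernel A B 0 x.ofLp T z))
        = ∫⁻ z, liminf (fun n => f n z) atTop := by
          congr 1; ext z; exact (hlim z).liminf_eq.symm
      _ ≤ liminf (fun n => ∫⁻ z, f n z) atTop := lintegral_liminf_le fun n =>
          (continuous_pairing_integrand hu _ _ _ _ _).measurable.ennreal_ofReal
      _ ≤ ENNReal.ofReal ((u (x, t) + δ) * kernelMass N) := by
          refine liminf_le_of_frequently_le' (Eventually.frequently ?_)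
          filter_upwards [eventually_pairing_zero_le (A := A) (B := B) hu hu0 x t hδ] with n hn
          rw [hf]
          simp only
          rw [lintegral_pairing hC hu hu0 (Real.exp_pos _) _ _ _ hT.le]
          exact ENNReal.ofReal_le_ofReal ((pairing_le_pairing_zero hA hC hB hu hK hu0
            (Real.exp_pos _) _ _ _ hT.le).trans hn)
  have hcont : Continuous fun δ : ℝ => ENNReal.ofReal ((u (x, t) + δ) * kernelMass N) :=
    ENNReal.continuous_ofReal.comp (by fun_prop)
  have h1 : Tendsto (fun δ : ℝ => ENNReal.ofReal ((u (x, t) + δ) * kernelMass N)) (𝓝[>] 0)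
      (𝓝 (ENNReal.ofReal (u (x, t) * kernelMass N))) := by
    simpa using (hcont.tendsto 0).mono_left nhdsWithin_le_nhds
  exact ge_of_tendsto h1 (by filter_upwards [self_mem_nhdsWithin] with δ hδ using key δ hδ)

lemma integrable_kernel (hA : A.PosSemidef) (hC : ∀ t : ℝ, 0 < t → (C A B t).PosDef)
    (hB : B.trace = 0) (hu : ContDiff ℝ ∞ u) (hK : ∀ z, K A B u z = 0) (hu0 : ∀ z, 0 ≤ u z)
    (x : 𝕍) (t : ℝ) {T : ℝ} (hT : 0 < T) :
    Integrable fun z => u (z, t - T) * Real.exp (logKernel A B 0 x.ofLp T z) := by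
  refine ⟨((continuous_slice hu _).mul (Real.continuous_exp.comp
    (contDiff_logKernel A B 0 x.ofLp T).continuous)).aestronglyMeasurable, ?_⟩
  rw [hasFiniteIntegral_iff_ofReal
    (Eventually.of_forall fun z => mul_nonneg (hu0 _) (Real.exp_pos _).le)]
  exact (lintegral_kernel_le hA hC hB hu hK hu0 x t hT).trans_lt ENNReal.ofReal_lt_top

lemma integral_kernel_le (hA : A.PosSemidef) (hC : ∀ t : ℝ, 0 < t → (C A B t).PosDef)
    (hB : B.trace = 0) (hu : ContDiff ℝ ∞ u) (hK : ∀ z, K A B u z = 0) (hu0 : ∀ z, 0 ≤ u z)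
    (x : 𝕍) (t : ℝ) {T : ℝ} (hT : 0 < T) :
    ∫ z, u (z, t - T) * Real.exp (logKernel A B 0 x.ofLp T z) ≤ u (x, t) * kernelMass N := by
  rw [← ENNReal.ofReal_le_ofReal_iff (mul_nonneg (hu0 _) (kernelMass_pos N).le),
    ofReal_integral_eq_lintegral_ofReal (integrable_kernel hA hC hB hu hK hu0 x t hT)
      (Eventually.of_forall fun z => mul_nonneg (hu0 _) (Real.exp_pos _).le)]
  exact lintegral_kernel_le hA hC hB hu hK hu0 x t hT

end LowerBound

/-! ### A nonnegative solution is bounded by its kernel average -/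

section UpperBound

open MeasureTheory Set
open scoped Matrix.Norms.Operator

variable {N : ℕ} {A B : Matrix (Fin N) (Fin N) ℝ}
  {u : EuclideanSpace ℝ (Fin N) × ℝ → ℝ}

local notation "𝕍" => EuclideanSpace ℝ (Fin N)

lemma transpose_mulVec_dotProduct_le (G : Matrix (Fin N) (Fin N) ℝ) (w : Fin N → ℝ) :
    (Gᵀ *ᵥ w) ⬝ᵥ (Gᵀ *ᵥ w) ≤ (G * Gᵀ).trace * (w ⬝ᵥ w) := by
  have h : (Gᵀ *ᵥ w) ⬝ᵥ (Gᵀ *ᵥ w) = w ⬝ᵥ (G * Gᵀ) *ᵥ w := by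
    rw [← mulVec_mulVec, dotProduct_mulVec w G, ← mulVec_transpose]
  rw [h]
  refine form_le_trace_mul ?_ w
  simpa [conjTranspose_eq_transpose_of_trivial] using posSemidef_self_mul_conjTranspose G

lemma real_dotProduct_self_nonneg (w : Fin N → ℝ) : 0 ≤ w ⬝ᵥ w := by
  simpa using dotProduct_star_self_nonneg w

/-- For small `ε` the mollified covariance at lag `r` is, after transport by `E(1)`, smaller than
the covariance at lag `r + 1` by a factor that is uniform on bounded intervals. -/
lemma exists_cov_form_le (hC : ∀ t : ℝ, 0 < t → (C A B t).PosDef) :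
    ∃ ε₀ : ℝ, 0 < ε₀ ∧ ∀ ε, 0 < ε → ε ≤ ε₀ → ∀ T, 0 ≤ T → ∃ θ : ℝ, 0 < θ ∧
      ∀ r ∈ Icc 0 T, ∀ w, (1 + θ) * (((E B 1)ᵀ *ᵥ w) ⬝ᵥ cov A B ε r *ᵥ ((E B 1)ᵀ *ᵥ w)) ≤
        w ⬝ᵥ C A B (1 + r) *ᵥ w := by
  have hC1 := hC 1 one_pos
  obtain ⟨lam, hlam, hl⟩ := exists_pos_mul_le_form hC1
  have hτ0 : 0 ≤ (E B 1 * (E B 1)ᵀ).trace := by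
    simpa [conjTranspose_eq_transpose_of_trivial] using
      (posSemidef_self_mul_conjTranspose (E B 1)).trace_nonneg
  set τ := (E B 1 * (E B 1)ᵀ).trace + 1 with hτ
  have hτ1 : 0 < τ := by positivity
  refine ⟨lam / τ / 2, by positivity, fun ε hε hε0 T hT => ?_⟩
  have hT0 : 0 ≤ (C A B T).trace := (posSemidef_C hC hT).trace_nonneg
  set a := lam / τ / 2 with ha
  have ha0 : 0 < a := by positivity
  set θ := a / (a + (C A B T).trace) with hθ
  have hθ0 : 0 < θ := by positivity
  refine ⟨θ, hθ0, fun r hr w => ?_⟩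
  set w' := (E B 1)ᵀ *ᵥ w with hw'
  have h1 : w' ⬝ᵥ w' ≤ τ * (w ⬝ᵥ w) :=
    (transpose_mulVec_dotProduct_le (E B 1) w).trans
      (mul_le_mul_of_nonneg_right (by linarith) (real_dotProduct_self_nonneg w))
  have h2 : 2 * a * (w' ⬝ᵥ w') ≤ w ⬝ᵥ C A B 1 *ᵥ w := by
    calc 2 * a * (w' ⬝ᵥ w') ≤ 2 * a * (τ * (w ⬝ᵥ w)) := by gcongr
      _ = lam * (w ⬝ᵥ w) := by rw [ha]; field_simp
      _ ≤ _ := hl w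
  have h3 : w' ⬝ᵥ C A B r *ᵥ w' ≤ (C A B T).trace * (w' ⬝ᵥ w') :=
    (C_form_mono hC hr.2 w').trans (form_le_trace_mul (posSemidef_C hC hT) w')
  have h4 : θ * (a + (C A B T).trace) = a := by rw [hθ]; field_simp
  have h5 := real_dotProduct_self_nonneg w'
  rw [C_form_add, cov_form]
  have h6 : θ * (w' ⬝ᵥ C A B r *ᵥ w') ≤ θ * ((C A B T).trace * (w' ⬝ᵥ w')) := by gcongr
  have h7 : (1 + θ) * (ε * (w' ⬝ᵥ w')) ≤ (1 + θ) * (a * (w' ⬝ᵥ w')) := by gcongr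
  have h8 : θ * (C A B T).trace * (w' ⬝ᵥ w') = (a - θ * a) * (w' ⬝ᵥ w') := by
    rw [show θ * (C A B T).trace = a - θ * a by rw [mul_add] at h4; linarith]
  nlinarith

/-- The squared gradient of the logarithmic kernel is controlled by the exponent of the kernel. -/
lemma grad_logKernel_form_le (hA : A.PosSemidef) (hC : ∀ t : ℝ, 0 < t → (C A B t).PosDef)
    {ε : ℝ} (hε : 0 < ε) (T : ℝ) : ∃ c : ℝ, 0 ≤ c ∧ ∀ r ∈ Icc 0 T, ∀ (x : Fin N → ℝ) (z : 𝕍),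
      grad (logKernel A B ε x r) z ⬝ᵥ A *ᵥ grad (logKernel A B ε x r) z ≤
        c * (disp B x r z ⬝ᵥ (cov A B ε r)⁻¹ *ᵥ disp B x r z) := by
  have hcont : Continuous fun r => ((E B r)ᵀ * (E B r)).trace :=
    ((continuous_E B).matrix_transpose.matrix_mul (continuous_E B)).matrix_trace
  obtain ⟨τ, hτ⟩ := (isCompact_Icc (a := (0 : ℝ)) (b := T)).exists_bound_of_continuousOn
    hcont.continuousOn
  have hA0 : 0 ≤ A.trace := hA.trace_nonneg
  refine ⟨A.trace * (1 / 4 * (|τ| * ε⁻¹)), by positivity, fun r hr x z => ?_⟩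
  rw [grad_logKernel hA.1]
  have hM := posDef_cov hC hε hr.1
  set v := disp B x r z
  set p := (cov A B ε r)⁻¹ *ᵥ v with hp
  have h1 : ε * (p ⬝ᵥ p) ≤ v ⬝ᵥ p := dotProduct_inv_mulVec_self_le hM (fun w => by
    rw [cov_form]
    linarith [form_nonneg (posSemidef_C hC hr.1) w]) v
  have h2 : ((E B r)ᵀ *ᵥ p) ⬝ᵥ ((E B r)ᵀ *ᵥ p) ≤ |τ| * (p ⬝ᵥ p) := by
    refine (transpose_mulVec_dotProduct_le (E B r) p).trans
      (mul_le_mul_of_nonneg_right ?_ (real_dotProduct_self_nonneg p))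
    rw [trace_mul_comm]
    exact (le_abs_self _).trans ((hτ r hr).trans (le_abs_self _))
  have h3 : p ⬝ᵥ p ≤ ε⁻¹ * (v ⬝ᵥ p) := by rwa [le_inv_mul_iff₀ hε]
  calc _ ≤ A.trace * (((-1 / 2 : ℝ) • ((E B r)ᵀ *ᵥ p)) ⬝ᵥ ((-1 / 2 : ℝ) • ((E B r)ᵀ *ᵥ p))) :=
        form_le_trace_mul hA _
    _ = A.trace * (1 / 4 * (((E B r)ᵀ *ᵥ p) ⬝ᵥ ((E B r)ᵀ *ᵥ p))) := by
        rw [dotProduct_smul, smul_dotProduct]; simp only [smul_eq_mul]; ring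
    _ ≤ A.trace * (1 / 4 * (|τ| * (ε⁻¹ * (v ⬝ᵥ p)))) := by
        gcongr
        exact h2.trans (by gcongr)
    _ = _ := by ring

/-- A power of the mollified kernel slightly below one, times the squared gradient of its
logarithm, is bounded by a kernel with a larger time lag. -/
lemma exists_exp_mul_grad_form_le (hA : A.PosSemidef) (hC : ∀ t : ℝ, 0 < t → (C A B t).PosDef) :
    ∃ ε₀ : ℝ, 0 < ε₀ ∧ ∀ ε, 0 < ε → ε ≤ ε₀ → ∀ T, 0 ≤ T → ∃ δ c : ℝ, 0 < δ ∧ δ ≤ 1 ∧ 0 ≤ c ∧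
      ∀ r ∈ Icc 0 T, ∀ (x : Fin N → ℝ) (z : 𝕍),
        Real.exp ((1 - δ) * logKernel A B ε x r z) *
          (grad (logKernel A B ε x r) z ⬝ᵥ A *ᵥ grad (logKernel A B ε x r) z) ≤
        c * Real.exp (logKernel A B 0 (E B 1 *ᵥ x) (1 + r) z) := by
  obtain ⟨ε₀, hε₀, hcov⟩ := exists_cov_form_le hC
  refine ⟨ε₀, hε₀, fun ε hε hle T hT => ?_⟩
  obtain ⟨θ, hθ, hform⟩ := hcov ε hε hle T hT
  obtain ⟨c₁, hc₁, hgrad⟩ := grad_logKernel_form_le (B := B) hA hC hε T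
  set δ := θ / (2 * (1 + θ)) with hδ
  have hδ0 : 0 < δ := by positivity
  have hδ1 : δ ≤ 1 := by
    rw [hδ, div_le_one (by positivity)]; linarith
  have hδθ : 1 - δ = (1 + θ)⁻¹ + δ := by rw [hδ]; field_simp; ring
  set c₂ := (1 - δ) * (-(N * Real.log ε) / 2) with hc₂
  set c₃ := Real.log (C A B (1 + T)).det / 2 with hc₃
  refine ⟨δ, c₁ * (4 / δ) * Real.exp (c₂ + c₃), hδ0, hδ1, by positivity, fun r hr x z => ?_⟩
  have hM := posDef_cov hC hε hr.1
  set v := disp B x r z with hv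
  set Z := v ⬝ᵥ (cov A B ε r)⁻¹ *ᵥ v with hZ
  have hZ0 : 0 ≤ Z := form_nonneg hM.inv.posSemidef v
  have hr1 : (0 : ℝ) < 1 + r := by linarith [hr.1]
  have hv' : disp B (E B 1 *ᵥ x) (1 + r) z = E B 1 *ᵥ v := by
    rw [hv, disp, disp, mulVec_sub, mulVec_mulVec, ← E_add]
  have h1 : (E B 1 *ᵥ v) ⬝ᵥ (C A B (1 + r))⁻¹ *ᵥ (E B 1 *ᵥ v) ≤ (1 + θ)⁻¹ * Z :=
    inv_form_mulVec_le (by positivity) (hC _ hr1) hM (fun w => hform r hr w) v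
  have h2 : Real.log (C A B (1 + r)).det ≤ Real.log (C A B (1 + T)).det :=
    Real.log_le_log (hC _ hr1).det_pos (det_C_mono hC hr1 (by linarith [hr.2]))
  have h3 : -c₃ - (1 + θ)⁻¹ * Z / 4 ≤ logKernel A B 0 (E B 1 *ᵥ x) (1 + r) z := by
    rw [logKernel, cov_zero, hv', hc₃]
    linarith
  have h4 : (1 - δ) * logKernel A B ε x r z ≤ c₂ - ((1 + θ)⁻¹ + δ) * (Z / 4) := by
    have h5 := log_det_cov_ge (B := B) hC hε hr.1
    have h6 : logKernel A B ε x r z ≤ -(N * Real.log ε) / 2 - Z / 4 := by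
      rw [logKernel]
      linarith
    calc _ ≤ (1 - δ) * (-(N * Real.log ε) / 2 - Z / 4) := by gcongr
      _ = c₂ - (1 - δ) * (Z / 4) := by rw [hc₂]; ring
      _ = _ := by rw [hδθ]
  have h7 : Z * Real.exp (-(δ * (Z / 4))) ≤ 4 / δ := by
    -- `y e⁻ʸ ≤ 1` at `y = δ Z / 4`
    have h8 := Real.add_one_le_exp (δ * (Z / 4))
    have h9 : Real.exp (δ * (Z / 4)) * Real.exp (-(δ * (Z / 4))) = 1 := by
      rw [← Real.exp_add]; simp
    have h10 := Real.exp_pos (-(δ * (Z / 4)))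
    rw [le_div_iff₀ hδ0]
    nlinarith
  calc _ ≤ Real.exp (c₂ - ((1 + θ)⁻¹ + δ) * (Z / 4)) * (c₁ * Z) := by
        refine mul_le_mul (Real.exp_le_exp.2 h4) (hgrad r hr x z) (form_nonneg hA _) (Real.exp_pos _).le
    _ = c₁ * (Z * Real.exp (-(δ * (Z / 4)))) *
          (Real.exp (c₂ + c₃) * Real.exp (-c₃ - (1 + θ)⁻¹ * Z / 4)) := by
        rw [← Real.exp_add, show c₂ - ((1 + θ)⁻¹ + δ) * (Z / 4) = -(δ * (Z / 4)) +
          (c₂ + c₃ + (-c₃ - (1 + θ)⁻¹ * Z / 4)) by ring, Real.exp_add]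
        ring
    _ ≤ c₁ * (4 / δ) * (Real.exp (c₂ + c₃) *
          Real.exp (logKernel A B 0 (E B 1 *ᵥ x) (1 + r) z)) := by gcongr
    _ = _ := by ring

/-- For small `ε` the pairing loses at most an exponentially small amount (in the truncation
level) between lag `0` and lag `T`. -/
lemma exists_pairing_zero_le (hA : A.PosSemidef) (hC : ∀ t : ℝ, 0 < t → (C A B t).PosDef)
    (hB : B.trace = 0) (hu : ContDiff ℝ ∞ u) (hK : ∀ z, K A B u z = 0) (hu0 : ∀ z, 0 ≤ u z) :
    ∃ ε₀ : ℝ, 0 < ε₀ ∧ ∀ ε, 0 < ε → ε ≤ ε₀ → ∀ T, 0 ≤ T → ∀ (x : 𝕍) (t : ℝ),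
      ∃ δ c : ℝ, 0 < δ ∧ ∀ k : ℝ, pairing A B u k ε x.ofLp t 0 ≤
        pairing A B u k ε x.ofLp t T + c * Real.exp (-δ * k) := by
  obtain ⟨ε₀, hε₀, hexp⟩ := exists_exp_mul_grad_form_le (B := B) hA hC
  refine ⟨ε₀, hε₀, fun ε hε hle T hT x t => ?_⟩
  obtain ⟨δ, c, hδ, hδ1, hc, hbound⟩ := hexp ε hε hle T hT
  set y : 𝕍 := WithLp.toLp 2 (E B 1 *ᵥ x.ofLp) with hy
  set c' := 6 * c * (u (y, t + 1) * kernelMass N) with hc'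
  refine ⟨δ, c' * T, hδ, fun k => ?_⟩
  have hder := fun r (hr : r ∈ interior (Icc 0 T)) =>
    hasDerivAt_pairing hA.1 hC hB hu hK hε k x.ofLp t (r := r)
      (by rw [interior_Icc] at hr; exact hr.1)
  have hdiss : ∀ r ∈ interior (Icc 0 T),
      ∫ z, dissipation A B u k ε x.ofLp t r z ≤ c' * Real.exp (-δ * k) := by
    intro r hr
    have hrI : r ∈ Icc 0 T := interior_subset hr
    rw [interior_Icc] at hr
    have hr1 : (0 : ℝ) < 1 + r := by linarith [hr.1]
    have et : t + 1 - (1 + r) = t - r := by ring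
    have hint := integrable_kernel hA hC hB hu hK hu0 y (t + 1) hr1
    have hle := integral_kernel_le hA hC hB hu hK hu0 y (t + 1) hr1
    rw [et] at hint hle
    calc ∫ z, dissipation A B u k ε x.ofLp t r z
        ≤ ∫ z, 6 * Real.exp (-δ * k) * c *
            (u (z, t - r) * Real.exp (logKernel A B 0 y.ofLp (1 + r) z)) := by
          refine integral_mono_of_nonneg
            (Eventually.of_forall fun z => dissipation_nonneg hA hu0 k ε x.ofLp t r z)
            (hint.const_mul _) (Eventually.of_forall fun z => ?_)
          have h1 := trunc₂_sub_trunc₁_le (show δ ≤ 2 by linarith) k (logKernel A B ε x.ofLp r z)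
          have h2 := hbound r hrI x.ofLp z
          have h3 := form_nonneg hA (grad (logKernel A B ε x.ofLp r) z)
          have h4 := hu0 (z, t - r)
          have h5 := Real.exp_pos (-δ * k)
          simp only [dissipation]
          calc _ ≤ u (z, t - r) * (6 * Real.exp (-δ * k) *
                Real.exp ((1 - δ) * logKernel A B ε x.ofLp r z) *
                (grad (logKernel A B ε x.ofLp r) z ⬝ᵥ A *ᵥ grad (logKernel A B ε x.ofLp r) z)) := by
                gcongr
            _ = u (z, t - r) * (6 * Real.exp (-δ * k) *
                (Real.exp ((1 - δ) * logKernel A B ε x.ofLp r z) *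
                (grad (logKernel A B ε x.ofLp r) z ⬝ᵥ A *ᵥ grad (logKernel A B ε x.ofLp r) z))) := by
                ring
            _ ≤ u (z, t - r) * (6 * Real.exp (-δ * k) *
                (c * Real.exp (logKernel A B 0 y.ofLp (1 + r) z))) := by gcongr
            _ = _ := by ring
      _ ≤ 6 * Real.exp (-δ * k) * c * (u (y, t + 1) * kernelMass N) := by
          rw [integral_const_mul]
          gcongr
      _ = _ := by rw [hc']; ring
  have h := (convex_Icc 0 T).mul_sub_le_image_sub_of_le_deriv
    (continuousOn_pairing hC hu hε k x.ofLp t T)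
    (fun r hr => (hder r hr).differentiableAt.differentiableWithinAt)
    (C := -(c' * Real.exp (-δ * k)))
    (fun r hr => by rw [(hder r hr).deriv]; exact neg_le_neg (hdiss r hr))
    0 (left_mem_Icc.2 hT) T (right_mem_Icc.2 hT) hT
  linarith

/-- If the truncated pairings at lag `T` stay below `R`, for all truncation levels and all small
`ε`, then so does the kernel mass times the value of the solution at the pole. -/
lemma mul_kernelMass_le_of_pairing_le (hA : A.PosSemidef)
    (hC : ∀ t : ℝ, 0 < t → (C A B t).PosDef)
    (hB : B.trace = 0) (hu : ContDiff ℝ ∞ u) (hK : ∀ z, K A B u z = 0) (hu0 : ∀ z, 0 ≤ u z)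
    (x : 𝕍) (t : ℝ) {T R ε₁ : ℝ} (hT : 0 ≤ T) (hε₁ : 0 < ε₁)
    (hR : ∀ ε, 0 < ε → ε ≤ ε₁ → ∀ k, pairing A B u k ε x.ofLp t T ≤ R) :
    u (x, t) * kernelMass N ≤ R := by
  obtain ⟨ε₀, hε₀, hpair⟩ := exists_pairing_zero_le hA hC hB hu hK hu0
  have hmass := kernelMass_pos N
  -- removing the truncation
  have h1 : ∀ ε, 0 < ε → ε ≤ min ε₀ ε₁ →
      ∫⁻ z, ENNReal.ofReal (u (z, t) * Real.exp (logKernel A B ε x.ofLp 0 z)) ≤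
        ENNReal.ofReal R := by
    intro ε hε hle
    obtain ⟨δ, c, hδ, hk⟩ := hpair ε hε (hle.trans (min_le_left _ _)) T hT x t
    have hlim : Tendsto (fun n : ℕ => ENNReal.ofReal (R + c * Real.exp (-δ * n))) atTop
        (𝓝 (ENNReal.ofReal R)) := by
      refine ENNReal.tendsto_ofReal ?_
      have h2 : Tendsto (fun n : ℕ => Real.exp (-δ * n)) atTop (𝓝 0) :=
        Real.tendsto_exp_atBot.comp
          ((tendsto_natCast_atTop_atTop).const_mul_atTop_of_neg (by linarith))
      simpa using (h2.const_mul c).const_add R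
    calc ∫⁻ z, ENNReal.ofReal (u (z, t) * Real.exp (logKernel A B ε x.ofLp 0 z))
        = ∫⁻ z, liminf (fun n : ℕ => ENNReal.ofReal
            (u (z, t - 0) * trunc n (logKernel A B ε x.ofLp 0 z))) atTop := by
          congr 1; ext z
          rw [sub_zero]
          exact (ENNReal.tendsto_ofReal ((tendsto_trunc tendsto_natCast_atTop_atTop
            tendsto_const_nhds).const_mul _)).liminf_eq.symm
      _ ≤ liminf (fun n : ℕ => ∫⁻ z, ENNReal.ofReal
            (u (z, t - 0) * trunc n (logKernel A B ε x.ofLp 0 z))) atTop :=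
          lintegral_liminf_le fun n =>
            (continuous_pairing_integrand hu _ _ _ _ _).measurable.ennreal_ofReal
      _ ≤ liminf (fun n : ℕ => ENNReal.ofReal (R + c * Real.exp (-δ * n))) atTop := by
          refine liminf_le_liminf (Eventually.of_forall fun n => ?_)
          rw [lintegral_pairing hC hu hu0 hε _ _ _ le_rfl]
          exact ENNReal.ofReal_le_ofReal ((hk n).trans
            (by linarith [hR ε hε (hle.trans (min_le_right _ _)) n]))
      _ = ENNReal.ofReal R := hlim.liminf_eq
  have hR0 : 0 ≤ R := by
    refine le_trans ?_ (hR ε₁ hε₁ le_rfl 0)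
    exact integral_nonneg fun z => mul_nonneg (hu0 _) (trunc_nonneg _ _)
  -- concentration at the pole
  have h2 : ∀ η : ℝ, 0 < η → (u (x, t) - η) * kernelMass N ≤ R := by
    intro η hη
    obtain ⟨ρ, hρ, hball⟩ := Metric.continuousAt_iff.1 (continuous_slice hu t).continuousAt η hη
    set s : ℝ → ℝ := fun ε => Real.exp (N * Real.log 2 / 2 - ρ ^ 2 / (8 * ε)) with hs
    have h3 : ∀ ε, 0 < ε → ε ≤ min ε₀ ε₁ →
        (u (x, t) - η) * kernelMass N - u (x, t) * s ε * kernelMass N ≤ R := by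
      intro ε hε hle
      have h2ε : 0 < 2 * ε := by positivity
      have hmeas : Continuous fun z => u (z, t) * Real.exp (logKernel A B ε x.ofLp 0 z) :=
        (continuous_slice hu _).mul (Real.continuous_exp.comp
          (contDiff_logKernel A B ε x.ofLp 0).continuous)
      have hnn : ∀ z, 0 ≤ u (z, t) * Real.exp (logKernel A B ε x.ofLp 0 z) := fun z =>
        mul_nonneg (hu0 _) (Real.exp_pos _).le
      have hint : Integrable fun z => u (z, t) * Real.exp (logKernel A B ε x.ofLp 0 z) := by
        refine ⟨hmeas.aestronglyMeasurable, ?_⟩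
        rw [hasFiniteIntegral_iff_ofReal (Eventually.of_forall hnn)]
        exact (h1 ε hε hle).trans_lt ENNReal.ofReal_lt_top
      have hle' : ∫ z, u (z, t) * Real.exp (logKernel A B ε x.ofLp 0 z) ≤ R := by
        rw [← ENNReal.ofReal_le_ofReal_iff hR0,
          ofReal_integral_eq_lintegral_ofReal hint (Eventually.of_forall hnn)]
        exact h1 ε hε hle
      have i1 := (integrable_exp_logKernel_zero A B hε x).const_mul (u (x, t) - η)
      have i2 := (integrable_exp_logKernel_zero A B h2ε x).const_mul (u (x, t) * s ε)
      refine le_trans ?_ hle'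
      rw [← integral_exp_logKernel_zero A B hε x, ← integral_const_mul,
        integral_exp_logKernel_zero A B hε x, ← integral_exp_logKernel_zero A B h2ε x,
        ← integral_const_mul (u (x, t) * s ε), ← integral_sub i1 i2]
      refine integral_mono (i1.sub i2) hint fun z => ?_
      have hux := hu0 (x, t)
      have e1 := Real.exp_pos (logKernel A B ε x.ofLp 0 z)
      have e2 := Real.exp_pos (logKernel A B (2 * ε) x.ofLp 0 z)
      have hs0 : 0 < s ε := Real.exp_pos _
      have hprod : 0 ≤ u (x, t) * s ε * Real.exp (logKernel A B (2 * ε) x.ofLp 0 z) := by positivity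
      simp only
      rcases lt_or_ge (dist z x) ρ with hz | hz
      · have h4 := hball hz
        rw [Real.dist_eq] at h4
        have h5 := (abs_lt.1 h4).1
        have : (u (x, t) - η) * Real.exp (logKernel A B ε x.ofLp 0 z) ≤
            u (z, t) * Real.exp (logKernel A B ε x.ofLp 0 z) := by gcongr; linarith
        linarith
      · -- away from the pole, the kernel is tiny compared with the kernel of twice the variance
        have h4 : Real.exp (logKernel A B ε x.ofLp 0 z) ≤
            s ε * Real.exp (logKernel A B (2 * ε) x.ofLp 0 z) := by
          rw [hs, ← Real.exp_add, Real.exp_le_exp, logKernel_zero A B hε,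
            logKernel_zero A B h2ε, Real.log_mul (by norm_num) hε.ne']
          have h5 : ρ ^ 2 / (8 * ε) ≤ ‖z - x‖ ^ 2 / (8 * ε) := by
            rw [dist_eq_norm] at hz
            gcongr
          have h6 : ‖z - x‖ ^ 2 / (4 * ε) = 2 * (‖z - x‖ ^ 2 / (8 * ε)) := by field_simp; ring
          have h7 : ‖z - x‖ ^ 2 / (4 * (2 * ε)) = ‖z - x‖ ^ 2 / (8 * ε) := by ring_nf
          rw [h6, h7]
          nlinarith
        have h5 : (u (x, t) - η) * Real.exp (logKernel A B ε x.ofLp 0 z) ≤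
            u (x, t) * (s ε * Real.exp (logKernel A B (2 * ε) x.ofLp 0 z)) :=
          calc _ ≤ u (x, t) * Real.exp (logKernel A B ε x.ofLp 0 z) := by gcongr; linarith
            _ ≤ _ := by gcongr
        linarith [hnn z]
    have hs0 : Tendsto s (𝓝[>] 0) (𝓝 0) := by
      refine Real.tendsto_exp_atBot.comp ?_
      have h4 : Tendsto (fun ε : ℝ => ρ ^ 2 / (8 * ε)) (𝓝[>] 0) atTop := by
        have : Tendsto (fun ε : ℝ => ρ ^ 2 / 8 * ε⁻¹) (𝓝[>] 0) atTop :=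
          tendsto_inv_nhdsGT_zero.const_mul_atTop (by positivity)
        refine this.congr fun ε => ?_
        rw [← div_div, div_eq_mul_inv _ ε]
      simpa [sub_eq_add_neg] using
        tendsto_const_nhds.add_atBot (tendsto_neg_atTop_atBot.comp h4)
    have h5 : Tendsto (fun ε => (u (x, t) - η) * kernelMass N - u (x, t) * s ε * kernelMass N)
        (𝓝[>] 0) (𝓝 ((u (x, t) - η) * kernelMass N)) := by
      simpa using ((hs0.const_mul (u (x, t))).mul_const (kernelMass N)).const_sub
        ((u (x, t) - η) * kernelMass N)
    refine le_of_tendsto h5 ?_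
    filter_upwards [Ioc_mem_nhdsGT (show 0 < min ε₀ ε₁ by positivity)] with ε hε
    exact h3 ε hε.1 hε.2
  have hcont : Continuous fun η : ℝ => (u (x, t) - η) * kernelMass N := by fun_prop
  have h3 : Tendsto (fun η : ℝ => (u (x, t) - η) * kernelMass N) (𝓝[>] 0)
      (𝓝 (u (x, t) * kernelMass N)) := by
    simpa using (hcont.tendsto 0).mono_left nhdsWithin_le_nhds
  exact le_of_tendsto h3 (by filter_upwards [self_mem_nhdsWithin] with η hη using h2 η hη)

end UpperBound

/-! ### The Harnack inequality -/

section Harnack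

open MeasureTheory Set
open scoped Matrix.Norms.Operator

variable {N : ℕ} {A B : Matrix (Fin N) (Fin N) ℝ}
  {u : EuclideanSpace ℝ (Fin N) × ℝ → ℝ}

local notation "𝕍" => EuclideanSpace ℝ (Fin N)

/-- Comparison of the kernels with poles `(x, t)` and `(x₀, t + h)` at a lag where the determinant
of the covariance grows by a factor at most two. -/
lemma logKernel_le_of_det_le (hC : ∀ t : ℝ, 0 < t → (C A B t).PosDef) {ε h T : ℝ} (hε : 0 < ε)
    (hh : 0 < h) (hT : 0 < T) (hdet : (C A B (T + h)).det ≤ 2 * (C A B T).det)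
    (hform : ∀ w, ε * (((E B h)ᵀ *ᵥ w) ⬝ᵥ ((E B h)ᵀ *ᵥ w)) ≤ 1 / 2 * (w ⬝ᵥ C A B h *ᵥ w))
    (x x₀ : Fin N → ℝ) (z : 𝕍) :
    logKernel A B ε x T z ≤ Real.log 2 / 2 +
      (E B h *ᵥ x - x₀) ⬝ᵥ (C A B h)⁻¹ *ᵥ (E B h *ᵥ x - x₀) / 2 + logKernel A B 0 x₀ (T + h) z := by
  have hCh := hC h hh
  have hCT := hC T hT
  have hTh := hC (h + T) (by linarith)
  have hX := posDef_cov hC hε hT.le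
  have hY : ((1 / 2 : ℝ) • C A B h).PosDef := hCh.smul (by norm_num)
  rw [add_comm T h] at hdet ⊢
  have hYinv : ((1 / 2 : ℝ) • C A B h)⁻¹ = (2 : ℝ) • (C A B h)⁻¹ := by
    refine inv_eq_left_inv ?_
    rw [smul_mul_smul_comm, nonsing_inv_mul _ (isUnit_iff_ne_zero.2 hCh.det_pos.ne')]
    norm_num
  have hd : disp B x₀ (h + T) z = E B h *ᵥ disp B x T z + (E B h *ᵥ x - x₀) := by
    rw [disp, disp, mulVec_sub, mulVec_mulVec, ← E_add]
    abel
  have h1 := inv_form_mulVec_add_le (G := E B h) hTh hX hY (fun w => by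
    rw [C_form_add, cov_form, smul_mulVec, dotProduct_smul, smul_eq_mul]
    linarith [hform w]) (disp B x T z) (E B h *ᵥ x - x₀)
  rw [← hd, hYinv, smul_mulVec, dotProduct_smul, smul_eq_mul] at h1
  have h2 : (C A B T).det ≤ (cov A B ε T).det := by
    rw [cov, add_comm]
    exact det_le_det_add hCT (posDef_smul_one hε).posSemidef
  have h3 : Real.log (C A B (h + T)).det ≤ Real.log 2 + Real.log (cov A B ε T).det := by
    rw [← Real.log_mul two_ne_zero hX.det_pos.ne']
    exact Real.log_le_log hTh.det_pos (by linarith)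
  rw [logKernel, logKernel, cov_zero]
  linarith

/-- Harnack inequality: the constant depends on the two points only through the cost
`⟨C(h)⁻¹b, b⟩`, `b = E(h)x - x₀`, of joining them. -/
lemma le_exp_mul (hA : A.PosSemidef) (hC : ∀ t : ℝ, 0 < t → (C A B t).PosDef)
    (hB : ∀ μ ∈ spectrum ℂ (B.map (fun r : ℝ => (r : ℂ))), μ.re = 0)
    (hu : ContDiff ℝ ∞ u) (hK : ∀ z, K A B u z = 0) (hu0 : ∀ z, 0 ≤ u z)
    (x x₀ : 𝕍) (t : ℝ) {h : ℝ} (hh : 0 < h) :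
    u (x, t) ≤ Real.exp (Real.log 2 / 2 + (E B h *ᵥ x.ofLp - x₀.ofLp) ⬝ᵥ (C A B h)⁻¹ *ᵥ
      (E B h *ᵥ x.ofLp - x₀.ofLp) / 2) * u (x₀, t + h) := by
  have hB0 := trace_eq_zero hB
  obtain ⟨T, hT, hdet⟩ := exists_det_C_ratio_le_two hC hB hh.le
  obtain ⟨lam, hlam, hl⟩ := exists_pos_mul_le_form (hC h hh)
  have hτ0 : 0 ≤ (E B h * (E B h)ᵀ).trace := by
    simpa [conjTranspose_eq_transpose_of_trivial] using
      (posSemidef_self_mul_conjTranspose (E B h)).trace_nonneg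
  set τ := (E B h * (E B h)ᵀ).trace + 1 with hτ
  have hτ1 : 0 < τ := by positivity
  set κ := Real.exp (Real.log 2 / 2 + (E B h *ᵥ x.ofLp - x₀.ofLp) ⬝ᵥ (C A B h)⁻¹ *ᵥ
      (E B h *ᵥ x.ofLp - x₀.ofLp) / 2) with hκ
  have hTh : 0 < T + h := by linarith
  have hint := integrable_kernel hA hC hB0 hu hK hu0 x₀ (t + h) hTh
  have hle := integral_kernel_le hA hC hB0 hu hK hu0 x₀ (t + h) hTh
  rw [show t + h - (T + h) = t - T by ring] at hint hle
  have hmain : u (x, t) * kernelMass N ≤ κ * (u (x₀, t + h) * kernelMass N) := by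
    refine mul_kernelMass_le_of_pairing_le hA hC hB0 hu hK hu0 x t hT.le
      (show 0 < lam / τ / 2 by positivity) fun ε hε hε1 k => ?_
    have hform : ∀ w, ε * (((E B h)ᵀ *ᵥ w) ⬝ᵥ ((E B h)ᵀ *ᵥ w)) ≤
        1 / 2 * (w ⬝ᵥ C A B h *ᵥ w) := fun w => by
      have hw := real_dotProduct_self_nonneg w
      calc _ ≤ lam / τ / 2 * (τ * (w ⬝ᵥ w)) := by
            gcongr
            · exact real_dotProduct_self_nonneg _
            · exact (transpose_mulVec_dotProduct_le (E B h) w).trans (by gcongr; linarith)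
        _ = 1 / 2 * (lam * (w ⬝ᵥ w)) := by field_simp
        _ ≤ _ := by gcongr; exact hl w
    calc pairing A B u k ε x.ofLp t T
        ≤ ∫ z, κ * (u (z, t - T) * Real.exp (logKernel A B 0 x₀.ofLp (T + h) z)) := by
          refine integral_mono_of_nonneg
            (Eventually.of_forall fun z => mul_nonneg (hu0 _) (trunc_nonneg _ _))
            (hint.const_mul κ) (Eventually.of_forall fun z => ?_)
          have h1 : trunc k (logKernel A B ε x.ofLp T z) ≤
              κ * Real.exp (logKernel A B 0 x₀.ofLp (T + h) z) := by
            rw [hκ, ← Real.exp_add]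
            exact (trunc_le_exp _ _).trans (Real.exp_le_exp.2
              (logKernel_le_of_det_le hC hε hh hT hdet hform x.ofLp x₀.ofLp z))
          calc _ ≤ u (z, t - T) * (κ * Real.exp (logKernel A B 0 x₀.ofLp (T + h) z)) :=
                mul_le_mul_of_nonneg_left h1 (hu0 _)
            _ = _ := by ring
      _ ≤ _ := by
          rw [integral_const_mul]
          exact mul_le_mul_of_nonneg_left hle (Real.exp_pos _).le
  rw [← mul_assoc] at hmain
  exact le_of_mul_le_mul_right hmain (kernelMass_pos N)

/-- The cost of joining two points tends to zero with time, so far enough in the past a nonnegative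
solution is controlled by its value at any given point, with a universal constant. -/
lemma eventually_le_exp_one_mul (hA : A.PosSemidef) (hC : ∀ t : ℝ, 0 < t → (C A B t).PosDef)
    (hB : ∀ μ ∈ spectrum ℂ (B.map (fun r : ℝ => (r : ℂ))), μ.re = 0)
    (hu : ContDiff ℝ ∞ u) (hK : ∀ z, K A B u z = 0) (hu0 : ∀ z, 0 ≤ u z)
    (x x₀ : 𝕍) (t₀ : ℝ) :
    ∀ᶠ t in atBot, u (x, t) ≤ Real.exp 1 * u (x₀, t₀) := by
  have hshift : Tendsto (fun t : ℝ => t₀ - t) atBot atTop :=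
    tendsto_atTop_add_const_left _ _ tendsto_neg_atBot_atTop
  filter_upwards [hshift.eventually (eventually_inv_form_C_le hC hB x₀.ofLp
      (show (0 : ℝ) < 1 / 4 by norm_num)),
    hshift.eventually (eventually_inv_form_C_E_le hC hB x.ofLp (show (0 : ℝ) < 1 / 4 by norm_num)),
    eventually_lt_atBot t₀] with t h1 h2 ht
  have hh : 0 < t₀ - t := by linarith
  have h3 := le_exp_mul hA hC hB hu hK hu0 x x₀ t hh
  rw [show t + (t₀ - t) = t₀ by ring] at h3
  refine h3.trans (mul_le_mul_of_nonneg_right (Real.exp_le_exp.2 ?_) (hu0 _))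
  set p := E B (t₀ - t) *ᵥ x.ofLp
  -- by the parallelogram law the cost at `p - x₀` is at most `2 * (1 / 4 + 1 / 4) = 1`
  have h4 := form_nonneg (hC _ hh).inv.posSemidef (p + x₀.ofLp)
  simp only [mulVec_add, mulVec_sub, dotProduct_add, add_dotProduct, dotProduct_sub,
    sub_dotProduct] at h4 ⊢
  have h5 := Real.log_two_lt_d9
  linarith

lemma K_sub_const (A B : Matrix (Fin N) (Fin N) ℝ) (u : EuclideanSpace ℝ (Fin N) × ℝ → ℝ) (c : ℝ)
    (z : EuclideanSpace ℝ (Fin N) × ℝ) : K A B (fun z => u z - c) z = K A B u z := by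
  simp [K, L, hessian, gradient, fderiv_sub_const, deriv_sub_const]

end Harnack

end OrnsteinUhlenbeck

theorem theorem1p2 {N : ℕ} (A B : Matrix (Fin N) (Fin N) ℝ)
    (hA : A.PosSemidef)
    (hC : ∀ t : ℝ, 0 < t → (OrnsteinUhlenbeck.C A B t).PosDef)
    (hB : ∀ μ ∈ spectrum ℂ (B.map (fun r : ℝ => (r : ℂ))), μ.re = 0)
    (u : EuclideanSpace ℝ (Fin N) × ℝ → ℝ)
    (hu : ContDiff ℝ ∞ u)
    (hK : ∀ z : EuclideanSpace ℝ (Fin N) × ℝ, OrnsteinUhlenbeck.K A B u z = 0)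
    (hbdd : BddBelow (Set.range u))
    (x : EuclideanSpace ℝ (Fin N)) :
    Tendsto (fun t : ℝ => u (x, t)) atBot (𝓝 (⨅ z, u z)) := by
  set m := ⨅ z, u z with hm
  have hm0 : ∀ z, m ≤ u z := fun z => ciInf_le hbdd z
  have hu' : ContDiff ℝ ∞ fun z => u z - m := hu.sub contDiff_const
  have hK' : ∀ z, OrnsteinUhlenbeck.K A B (fun z => u z - m) z = 0 := fun z => by
    rw [OrnsteinUhlenbeck.K_sub_const, hK]
  rw [Metric.tendsto_nhds]
  intro δ hδ
  have he := Real.exp_pos 1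
  obtain ⟨⟨x₀, t₀⟩, hz⟩ := exists_lt_of_ciInf_lt (show ⨅ z, u z < m + δ / Real.exp 1 by
    rw [← hm]; have : 0 < δ / Real.exp 1 := by positivity
    linarith)
  filter_upwards [OrnsteinUhlenbeck.eventually_le_exp_one_mul hA hC hB hu' hK'
    (fun z => sub_nonneg.2 (hm0 z)) x x₀ t₀] with t ht
  rw [Real.dist_eq, abs_of_nonneg (sub_nonneg.2 (hm0 _))]
  have h1 : u (x₀, t₀) - m < δ / Real.exp 1 := by linarith
  rw [lt_div_iff₀ he] at h1
  linarith
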